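/- Let $\mathbb D$ be the open unit disk in $\mathbb C$, let $1 \le p < 2$, and let $\beta\in\mathbb R$ satisfy $p\beta < 1$. Then every homeomorphism $\varphi\colon \partial\mathbb D \to \partial\mathbb D$ of the unit circle onto itself extends to a homeomorphism $h\colon \overline{\mathbb D} \to \overline{\mathbb D}$ of the closed unit disk onto itself which is locally Lipschitz in $\mathbb D$ and for which $$\int_{\mathbb D} \frac{|Dh(z)|^p}{(1-|h(z)|)^{p\beta}}\,dz < \infty,$$ where $|Dh(z)|$ is the operator norm of the differential of $h$ at $z$ (which exists for almost every $z\in\mathbb D$) and $dz$ is planar Lebesgue measure. -/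

import Mathlib

open MeasureTheory Metric
open scoped ENNReal

/-- The weighted energy `∫_𝔻 |Dh(z)|^p / (1 - |h(z)|)^(p β) dz` over the open unit disk, as a value
in `[0, ∞]`, where `|Dh(z)|` is the operator norm of the (real) differential `Dh(z) : ℂ → ℂ` and
`dz` is planar Lebesgue measure. It is used for maps that are locally Lipschitz in the open disk,
which are differentiable almost everywhere there, with `fderiv` as their weak differential. -/
noncomputable def weightedEnergy (p β : ℝ) (h : ℂ → ℂ) : ℝ≥0∞ :=
  ∫⁻ z in ball (0 : ℂ) 1, ENNReal.ofReal (‖fderiv ℝ h z‖ ^ p / (1 - ‖h z‖) ^ (p * β))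

/-! Up to conjugation, the circle map lifts to an increasing Φ on ℝ commuting with translation by
2π. Averaging Φ over the lines x + ty against a kernel k of mass 1, mean 0 and second moment 1 gives
a plane map F = `planeExt Φ`, which descends through z ↦ exp(iz), upper half-plane to punctured
disk.

Monotonicity of Φ makes F strictly monotone (`planeExt_inner_pos`), hence injective and height-sign
preserving. The moments of k keep F within bounded distance of the identity, which gives
surjectivity.

Write y for the height of z and v for the height of F(z). Two facts carry the energy estimate. The
first is a Harnack-type bound: the local Lipschitz constant of F at z is at most a multiple of v/y
(`norm_planeExt_sub_le`), with no smoothness of Φ. The second is that v has mean exactly y on each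
horizontal line (`setIntegral_planeExt_im`).

Since 1 - |h| = 1 - exp(-v), the density is bounded by a constant multiple of 1 + y^a (1 + v/y)
(`exists_density_le`). This is affine in v, so averaging over a circle leaves a multiple of 1 + 2(1
- r)^a, and p < 2 together with pβ < 1 gives a > -1. -/

/-- A lift to the line of an orientation preserving homeomorphism of the circle. -/
structure IsCircleLift (Φ : ℝ → ℝ) : Prop where
  continuous : Continuous Φ
  strictMono : StrictMono Φ
  add_two_pi : ∀ t, Φ (t + 2 * Real.pi) = Φ t + 2 * Real.pi

/-! ### Moments of the averaging kernel -/

/-- The probability density proportional to `(1 + t²)⁻²`; its second moment equals `1`. -/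
noncomputable def quarticKernel (t : ℝ) : ℝ := 2 / Real.pi * ((1 + t ^ 2) ^ 2)⁻¹

lemma quarticKernel_pos (t : ℝ) : 0 < quarticKernel t := by
  have := Real.pi_pos
  unfold quarticKernel
  positivity

lemma continuous_quarticKernel : Continuous quarticKernel := by
  unfold quarticKernel
  refine continuous_const.mul (Continuous.inv₀ (by fun_prop) fun t => by positivity)

lemma quarticKernel_neg (t : ℝ) : quarticKernel (-t) = quarticKernel t := by
  simp [quarticKernel]

lemma one_add_sq_mul_quarticKernel (t : ℝ) :
    (1 + t ^ 2) * quarticKernel t = 2 / Real.pi * (1 + t ^ 2)⁻¹ := by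
  have : (1 + t ^ 2) ≠ 0 := by positivity
  have := Real.pi_ne_zero
  unfold quarticKernel
  field_simp

/-- Multiplying the kernel by 1 + t² leaves a multiple of the Cauchy density, so quadratic growth is
still integrable. -/
lemma integrable_mul_quarticKernel {f : ℝ → ℝ} (hf : Continuous f) {A : ℝ}
    (hA : ∀ t, |f t| ≤ A * (1 + t ^ 2)) : Integrable fun t => f t * quarticKernel t := by
  refine ((integrable_inv_one_add_sq.const_mul (2 / Real.pi)).const_mul A).mono'
    (hf.mul continuous_quarticKernel).aestronglyMeasurable (.of_forall fun t => ?_)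
  rw [Real.norm_eq_abs, abs_mul, abs_of_pos (quarticKernel_pos t), ← one_add_sq_mul_quarticKernel,
    ← mul_assoc]
  exact mul_le_mul_of_nonneg_right (hA t) (quarticKernel_pos t).le

lemma integrable_quarticKernel : Integrable quarticKernel := by
  simpa using integrable_mul_quarticKernel (f := fun _ => 1) continuous_const (A := 1)
    fun t => by simp; positivity

lemma integrable_id_mul_quarticKernel : Integrable fun t => t * quarticKernel t :=
  integrable_mul_quarticKernel continuous_id (A := 1) fun t => by
    rcases abs_cases t with h | h <;> nlinarith [sq_nonneg (t - 1), sq_nonneg (t + 1)]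

lemma integrable_sq_mul_quarticKernel : Integrable fun t => t ^ 2 * quarticKernel t :=
  integrable_mul_quarticKernel (by fun_prop) (A := 1) fun t => by
    rw [abs_of_nonneg (sq_nonneg t)]; linarith

lemma integral_quarticKernel : ∫ t, quarticKernel t = 1 := by
  have hd : ∀ t : ℝ, HasDerivAt
      (fun t : ℝ => 1 / Real.pi * (t * (1 + t ^ 2)⁻¹ + Real.arctan t)) (quarticKernel t) t := by
    intro t
    have h0 : (1 + t ^ 2) ≠ 0 := by positivity
    have h1 : HasDerivAt (fun t : ℝ => 1 + t ^ 2) (2 * t) t := by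
      simpa using (hasDerivAt_pow 2 t).const_add 1
    convert! (((hasDerivAt_id t).mul (h1.inv h0)).add (Real.hasDerivAt_arctan t)).const_mul
      (1 / Real.pi) using 1
    have := Real.pi_ne_zero
    simp only [quarticKernel, id, Pi.inv_apply]
    field_simp
    ring
  have hz : Filter.Tendsto (fun t : ℝ => t * (1 + t ^ 2)⁻¹) (Filter.cocompact ℝ) (nhds 0) := by
    have hi : Filter.Tendsto (fun t : ℝ => ‖t‖⁻¹) (Filter.cocompact ℝ) (nhds 0) :=
      tendsto_inv_atTop_zero.comp (tendsto_norm_cocompact_atTop)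
    refine squeeze_zero_norm' ?_ hi
    filter_upwards [(tendsto_norm_cocompact_atTop (E := ℝ)).eventually_gt_atTop 0] with t ht
    rw [norm_mul, norm_inv, Real.norm_of_nonneg (by positivity : 0 ≤ 1 + t ^ 2), ← div_eq_mul_inv,
      div_le_iff₀ (by positivity), ← Real.norm_of_nonneg (sq_nonneg t), norm_pow]
    field_simp
    linarith
  rw [integral_of_hasDerivAt_of_tendsto hd integrable_quarticKernel
    (((hz.mono_left atBot_le_cocompact).add
      (Real.tendsto_arctan_atBot.mono_right nhdsWithin_le_nhds)).const_mul _)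
    (((hz.mono_left atTop_le_cocompact).add
      (Real.tendsto_arctan_atTop.mono_right nhdsWithin_le_nhds)).const_mul _)]
  have := Real.pi_ne_zero
  field_simp
  ring

lemma integral_id_mul_quarticKernel : ∫ t, t * quarticKernel t = 0 := by
  have h := integral_neg_eq_self (fun t => t * quarticKernel t) volume
  simp only [quarticKernel_neg, neg_mul, integral_neg] at h
  linarith

lemma integral_sq_mul_quarticKernel : ∫ t, t ^ 2 * quarticKernel t = 1 := by
  have h : ∫ t, (1 + t ^ 2) * quarticKernel t = 2 := by
    simp_rw [one_add_sq_mul_quarticKernel, integral_const_mul, integral_univ_inv_one_add_sq]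
    have := Real.pi_ne_zero
    field_simp
  simp_rw [add_mul, one_mul] at h
  rw [integral_add integrable_quarticKernel integrable_sq_mul_quarticKernel,
    integral_quarticKernel] at h
  linarith

/-! ### The plane extension is a homeomorphism close to the identity -/

/-- The extension of a function on the line to the plane by averaging over the lines through the
origin against `quarticKernel`. For an increasing function it is the gradient of a convex
function. -/
noncomputable def planeExt (Φ : ℝ → ℝ) (z : ℂ) : ℂ :=
  ⟨∫ t, Φ (z.re + t * z.im) * quarticKernel t, ∫ t, Φ (z.re + t * z.im) * t * quarticKernel t⟩

namespace IsCircleLift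

variable {Φ : ℝ → ℝ}
lemma exists_bound (hΦ : IsCircleLift Φ) : ∃ B, 0 < B ∧ ∀ t, |Φ t - t| ≤ B := by
  have hp : Function.Periodic (fun t => Φ t - t) (2 * Real.pi) := fun t => by
    simp only [hΦ.add_two_pi]; ring
  obtain ⟨B, hB⟩ := (hp.isBounded_of_continuous (by positivity)
    (hΦ.continuous.sub continuous_id)).exists_norm_le
  exact ⟨max B 1, by positivity, fun t => (hB _ ⟨t, rfl⟩).trans (le_max_left _ _)⟩

lemma continuous_line (hΦ : IsCircleLift Φ) (x y : ℝ) : Continuous fun t => Φ (x + t * y) :=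
  hΦ.continuous.comp (by fun_prop)

lemma integrable_mul_pow (hΦ : IsCircleLift Φ) (x y : ℝ) :
    Integrable (fun t => Φ (x + t * y) * quarticKernel t) ∧
      Integrable fun t => Φ (x + t * y) * t * quarticKernel t := by
  obtain ⟨B, hB0, hB⟩ := hΦ.exists_bound
  have key : ∀ t, |Φ (x + t * y)| ≤ |x| + |t| * |y| + B := fun t => by
    have h1 := hB (x + t * y)
    have h2 := abs_add_le x (t * y)
    have h3 := abs_add_le (Φ (x + t * y) - (x + t * y)) (x + t * y)
    rw [sub_add_cancel] at h3
    rw [abs_mul] at h2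
    linarith
  have hx := abs_nonneg x
  have hy := abs_nonneg y
  constructor
  · refine integrable_mul_quarticKernel (hΦ.continuous_line x y) (A := |x| + |y| + B)
      fun t => (key t).trans ?_
    have ht : |t| ≤ 1 + t ^ 2 := by rw [← sq_abs]; nlinarith [sq_nonneg (|t| - 1)]
    have := mul_le_mul_of_nonneg_right ht hy
    nlinarith [sq_nonneg t]
  · refine integrable_mul_quarticKernel ((hΦ.continuous_line x y).mul continuous_id)
      (A := |x| + |y| + B) fun t => ?_
    simp only [abs_mul]
    refine (mul_le_mul_of_nonneg_right (key t) (abs_nonneg t)).trans ?_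
    have ht : |t| ≤ 1 + t ^ 2 := by rw [← sq_abs]; nlinarith [sq_nonneg (|t| - 1)]
    have h1 := mul_le_mul_of_nonneg_right ht (by positivity : 0 ≤ |x| + B)
    have h2 : |t| * |t| = t ^ 2 := by rw [← sq, sq_abs]
    nlinarith

/-- The moments of the kernel make the extension of the identity the identity. Splitting it off
leaves the bounded function Φ(s) - s, suited to dominated convergence. -/
lemma planeExt_re (hΦ : IsCircleLift Φ) (z : ℂ) : (planeExt Φ z).re =
    z.re + ∫ t, (Φ (z.re + t * z.im) - (z.re + t * z.im)) * quarticKernel t := by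
  have h1 : ∫ t, (z.re + t * z.im) * quarticKernel t = z.re := by
    simp_rw [add_mul, mul_right_comm _ z.im]
    rw [integral_add (integrable_quarticKernel.const_mul _)
      (integrable_id_mul_quarticKernel.mul_const _), integral_const_mul, integral_mul_const,
      integral_quarticKernel, integral_id_mul_quarticKernel]
    ring
  have h2 : Integrable fun t => (z.re + t * z.im) * quarticKernel t := by
    simp_rw [add_mul, mul_right_comm _ z.im]
    exact (integrable_quarticKernel.const_mul _).add (integrable_id_mul_quarticKernel.mul_const _)
  simp_rw [sub_mul]
  rw [integral_sub (hΦ.integrable_mul_pow _ _).1 h2, h1, planeExt]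
  ring

lemma planeExt_im (hΦ : IsCircleLift Φ) (z : ℂ) : (planeExt Φ z).im =
    z.im + ∫ t, (Φ (z.re + t * z.im) - (z.re + t * z.im)) * t * quarticKernel t := by
  have e : ∀ t, (z.re + t * z.im) * t * quarticKernel t =
      z.re * (t * quarticKernel t) + t ^ 2 * quarticKernel t * z.im := fun t => by ring
  have h1 : ∫ t, (z.re + t * z.im) * t * quarticKernel t = z.im := by
    simp_rw [e]
    rw [integral_add (integrable_id_mul_quarticKernel.const_mul _)
      (integrable_sq_mul_quarticKernel.mul_const _), integral_const_mul, integral_mul_const,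
      integral_sq_mul_quarticKernel, integral_id_mul_quarticKernel]
    ring
  have h2 : Integrable fun t => (z.re + t * z.im) * t * quarticKernel t := by
    simp_rw [e]
    exact (integrable_id_mul_quarticKernel.const_mul _).add
      (integrable_sq_mul_quarticKernel.mul_const _)
  simp_rw [sub_mul]
  rw [integral_sub (hΦ.integrable_mul_pow _ _).2 h2, h1, planeExt]
  ring

lemma abs_mul_quarticKernel_le {a B : ℝ} (h : |a| ≤ B) (t : ℝ) :
    ‖a * quarticKernel t‖ ≤ B * quarticKernel t ∧
      ‖a * t * quarticKernel t‖ ≤ B * (|t| * quarticKernel t) := by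
  have := quarticKernel_pos t
  simp only [Real.norm_eq_abs, abs_mul, abs_of_pos this]
  constructor
  · gcongr
  · rw [← mul_assoc]; gcongr

lemma integrable_abs_mul_quarticKernel : Integrable fun t => |t| * quarticKernel t := by
  refine integrable_id_mul_quarticKernel.norm.congr (.of_forall fun t => ?_)
  simp [abs_of_pos (quarticKernel_pos t)]

lemma continuous_planeExt (hΦ : IsCircleLift Φ) : Continuous (planeExt Φ) := by
  obtain ⟨B, hB0, hB⟩ := hΦ.exists_bound
  have hc := hΦ.continuous
  have hk := continuous_quarticKernel
  have hre : Continuous fun z => (planeExt Φ z).re := by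
    simp_rw [hΦ.planeExt_re]
    refine Complex.continuous_re.add (continuous_of_dominated (fun z => ?_)
      (fun z => .of_forall fun t => (abs_mul_quarticKernel_le (hB _) t).1)
      (integrable_quarticKernel.const_mul B) (.of_forall fun t => ?_))
    · exact Continuous.aestronglyMeasurable (by fun_prop)
    · fun_prop
  have him : Continuous fun z => (planeExt Φ z).im := by
    simp_rw [hΦ.planeExt_im]
    refine Complex.continuous_im.add (continuous_of_dominated (fun z => ?_)
      (fun z => .of_forall fun t => (abs_mul_quarticKernel_le (hB _) t).2)
      (integrable_abs_mul_quarticKernel.const_mul B) (.of_forall fun t => ?_))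
    · exact Continuous.aestronglyMeasurable (by fun_prop)
    · fun_prop
  exact (Complex.equivRealProdCLM.symm.continuous.comp (hre.prodMk him))

lemma exists_abs_planeExt_sub_le (hΦ : IsCircleLift Φ) : ∃ C, 0 < C ∧ ∀ z,
    |(planeExt Φ z).re - z.re| ≤ C ∧ |(planeExt Φ z).im - z.im| ≤ C := by
  obtain ⟨B, hB0, hB⟩ := hΦ.exists_bound
  refine ⟨max B (B * ∫ t, |t| * quarticKernel t), by positivity, fun z => ⟨?_, ?_⟩⟩
  · refine le_trans ?_ (le_max_left _ _)
    rw [hΦ.planeExt_re, add_sub_cancel_left, ← mul_one B, ← integral_quarticKernel,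
      ← integral_const_mul]
    exact norm_integral_le_of_norm_le (integrable_quarticKernel.const_mul B)
      (.of_forall fun t => (abs_mul_quarticKernel_le (hB _) t).1)
  · refine le_trans ?_ (le_max_right _ _)
    rw [hΦ.planeExt_im, add_sub_cancel_left, ← integral_const_mul]
    exact norm_integral_le_of_norm_le (integrable_abs_mul_quarticKernel.const_mul B)
      (.of_forall fun t => (abs_mul_quarticKernel_le (hB _) t).2)

lemma planeExt_ofReal (x : ℝ) : planeExt Φ x = Φ x := by
  apply Complex.ext
  · simp [planeExt, integral_const_mul, integral_quarticKernel]
  · simp [planeExt, integral_const_mul, integral_id_mul_quarticKernel, mul_assoc]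

lemma planeExt_add_two_pi (hΦ : IsCircleLift Φ) (z : ℂ) :
    planeExt Φ (z + 2 * Real.pi) = planeExt Φ z + 2 * Real.pi := by
  have e : ∀ t : ℝ, z.re + 2 * Real.pi + t * z.im = z.re + t * z.im + 2 * Real.pi :=
    fun t => by ring
  apply Complex.ext
  · rw [hΦ.planeExt_re, Complex.add_re (planeExt Φ z), hΦ.planeExt_re]
    simp only [Complex.add_re, Complex.add_im, Complex.mul_re, Complex.mul_im, Complex.ofReal_re,
      Complex.ofReal_im, Complex.re_ofNat, Complex.im_ofNat, mul_zero, zero_mul, sub_zero,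
      add_zero, e, hΦ.add_two_pi, add_sub_add_right_eq_sub]
    ring
  · rw [hΦ.planeExt_im, Complex.add_im (planeExt Φ z), hΦ.planeExt_im]
    simp only [Complex.add_re, Complex.add_im, Complex.mul_re, Complex.mul_im, Complex.ofReal_re,
      Complex.ofReal_im, Complex.re_ofNat, Complex.im_ofNat, mul_zero, zero_mul, sub_zero,
      add_zero, e, hΦ.add_two_pi, add_sub_add_right_eq_sub]

lemma planeExt_add_int_mul (hΦ : IsCircleLift Φ) (z : ℂ) (n : ℤ) :
    planeExt Φ (z + n * (2 * Real.pi)) = planeExt Φ z + n * (2 * Real.pi) := by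
  have hp : Function.Periodic (fun z => planeExt Φ z - z) (2 * Real.pi : ℂ) := fun z => by
    simp only [hΦ.planeExt_add_two_pi]; ring
  have := hp.int_mul n z
  linear_combination this

/-- Strict monotonicity of the extension in the sense of Minty. -/
lemma planeExt_inner_pos (hΦ : IsCircleLift Φ) {z w : ℂ} (h : z ≠ w) :
    0 < ((planeExt Φ z).re - (planeExt Φ w).re) * (z.re - w.re) +
      ((planeExt Φ z).im - (planeExt Φ w).im) * (z.im - w.im) := by
  -- The inner product is the integral of f, which is nonnegative because Φ is increasing.
  set f : ℝ → ℝ := fun t => (Φ (z.re + t * z.im) - Φ (w.re + t * w.im)) *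
    ((z.re + t * z.im) - (w.re + t * w.im)) * quarticKernel t with hf
  obtain ⟨hz1, hz2⟩ := hΦ.integrable_mul_pow z.re z.im
  obtain ⟨hw1, hw2⟩ := hΦ.integrable_mul_pow w.re w.im
  have hfe : f = fun t => (Φ (z.re + t * z.im) * quarticKernel t -
      Φ (w.re + t * w.im) * quarticKernel t) * (z.re - w.re) +
      (Φ (z.re + t * z.im) * t * quarticKernel t -
      Φ (w.re + t * w.im) * t * quarticKernel t) * (z.im - w.im) := by
    ext t; simp only [hf]; ring
  have hi1 : Integrable fun t => (Φ (z.re + t * z.im) * quarticKernel t -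
      Φ (w.re + t * w.im) * quarticKernel t) * (z.re - w.re) := (hz1.sub hw1).mul_const _
  have hi2 : Integrable fun t => (Φ (z.re + t * z.im) * t * quarticKernel t -
      Φ (w.re + t * w.im) * t * quarticKernel t) * (z.im - w.im) := (hz2.sub hw2).mul_const _
  have hfi : Integrable f := hfe ▸ hi1.add hi2
  have hfc : Continuous f := by
    have := hΦ.continuous
    have := continuous_quarticKernel
    fun_prop
  have hpos : ∀ a b : ℝ, a ≠ b → 0 < (Φ a - Φ b) * (a - b) := fun a b hab => by
    rcases lt_or_gt_of_ne hab with h | h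
    · exact mul_pos_of_neg_of_neg (sub_neg.2 (hΦ.strictMono h)) (sub_neg.2 h)
    · exact mul_pos (sub_pos.2 (hΦ.strictMono h)) (sub_pos.2 h)
  have hf0 : 0 ≤ f := fun t => by
    refine mul_nonneg ?_ (quarticKernel_pos t).le
    by_cases hab : z.re + t * z.im = w.re + t * w.im
    · simp [hab]
    · exact (hpos _ _ hab).le
  -- Affine functions of t agreeing at 0 and 1 have the same coefficients, which would force z = w.
  have hex : ∃ t, f t ≠ 0 := by
    have : ∃ t : ℝ, z.re + t * z.im ≠ w.re + t * w.im := by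
      by_contra! hc
      have h0 := hc 0
      have h1 := hc 1
      exact h (Complex.ext (by linarith) (by linarith))
    obtain ⟨t, ht⟩ := this
    exact ⟨t, (mul_pos (hpos _ _ ht) (quarticKernel_pos t)).ne'⟩
  have key := (integral_pos_iff_support_of_nonneg hf0 hfi).2
    (hfc.isOpen_support.measure_pos volume hex)
  rw [hfe, integral_add hi1 hi2,
    integral_mul_const, integral_mul_const, integral_sub hz1 hw1, integral_sub hz2 hw2] at key
  exact key

lemma planeExt_injective (hΦ : IsCircleLift Φ) : Function.Injective (planeExt Φ) := by
  intro z w h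
  by_contra hne
  simpa [h] using hΦ.planeExt_inner_pos hne

/-- Strict monotonicity is applied to z and its real part, whose image is real. -/
lemma planeExt_im_mul_pos (hΦ : IsCircleLift Φ) {z : ℂ} (h : z.im ≠ 0) :
    0 < (planeExt Φ z).im * z.im := by
  have := hΦ.planeExt_inner_pos (z := z) (w := (z.re : ℂ)) fun hz => h (by rw [hz]; simp)
  simpa [planeExt_ofReal] using this

lemma planeExt_im_pos_iff (hΦ : IsCircleLift Φ) (z : ℂ) : 0 < (planeExt Φ z).im ↔ 0 < z.im := by
  by_cases h : z.im = 0
  · have : z = (z.re : ℂ) := Complex.ext (by simp) (by simp [h])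
    rw [this, planeExt_ofReal]; simp
  · have := hΦ.planeExt_im_mul_pos h
    exact ⟨fun h1 => (pos_iff_pos_of_mul_pos this).1 h1, fun h1 => (pos_iff_pos_of_mul_pos this).2 h1⟩

lemma planeExt_im_neg_iff (hΦ : IsCircleLift Φ) (z : ℂ) : (planeExt Φ z).im < 0 ↔ z.im < 0 := by
  by_cases h : z.im = 0
  · have : z = (z.re : ℂ) := Complex.ext (by simp) (by simp [h])
    rw [this, planeExt_ofReal]; simp
  · have := hΦ.planeExt_im_mul_pos h
    exact ⟨fun h1 => (neg_iff_neg_of_mul_pos this).1 h1, fun h1 => (neg_iff_neg_of_mul_pos this).2 h1⟩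

/-- Two intermediate value arguments replace degree theory: at each height y a unique X(y) gives the
right real part, and along this continuous curve the imaginary part stays within C of y. -/
lemma planeExt_surjective (hΦ : IsCircleLift Φ) : Function.Surjective (planeExt Φ) := by
  obtain ⟨C, hC0, hC⟩ := hΦ.exists_abs_planeExt_sub_le
  have hcont := hΦ.continuous_planeExt
  have hre : ∀ y : ℝ, StrictMono fun x : ℝ => (planeExt Φ ⟨x, y⟩).re := fun y a b hab => by
    have := hΦ.planeExt_inner_pos (z := ⟨b, y⟩) (w := ⟨a, y⟩) fun h => hab.ne' (congrArg Complex.re h)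
    simp only [sub_self, mul_zero, add_zero] at this
    exact sub_pos.1 ((mul_pos_iff_of_pos_right (sub_pos.2 hab)).1 this)
  have hmk : Continuous fun p : ℝ × ℝ => (⟨p.1, p.2⟩ : ℂ) :=
    Complex.equivRealProdCLM.symm.continuous
  have hmk2 : ∀ x : ℝ, Continuous fun y : ℝ => (⟨x, y⟩ : ℂ) := fun x =>
    hmk.comp (by fun_prop : Continuous fun y : ℝ => (x, y))
  have hmk1 : ∀ y : ℝ, Continuous fun x : ℝ => (⟨x, y⟩ : ℂ) := fun y =>
    hmk.comp (by fun_prop : Continuous fun x : ℝ => (x, y))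
  intro w
  have hx : ∀ y : ℝ, ∃ x : ℝ, (planeExt Φ ⟨x, y⟩).re = w.re := fun y => by
    refine mem_range_of_exists_le_of_exists_ge (Complex.continuous_re.comp (hcont.comp (hmk1 y)))
      ⟨w.re - C, ?_⟩ ⟨w.re + C, ?_⟩
    · have := abs_le.1 (hC ⟨w.re - C, y⟩).1
      simp only at this ⊢; linarith
    · have := abs_le.1 (hC ⟨w.re + C, y⟩).1
      simp only at this ⊢; linarith
  choose X hX using hx
  have hXc : Continuous X := by
    refine continuous_iff_continuousAt.2 fun y => ?_
    rw [ContinuousAt, tendsto_order]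
    refine ⟨fun a ha => ?_, fun a ha => ?_⟩
    · have h1 : (planeExt Φ ⟨a, y⟩).re < w.re := hX y ▸ hre y ha
      filter_upwards [(Complex.continuous_re.comp (hcont.comp (hmk2 a))).continuousAt.eventually_lt
        continuousAt_const h1] with y' hy'
      exact (hre y').lt_iff_lt.1 (by simpa [hX y'] using hy')
    · have h1 : w.re < (planeExt Φ ⟨a, y⟩).re := hX y ▸ hre y ha
      filter_upwards [continuousAt_const.eventually_lt
        (Complex.continuous_re.comp (hcont.comp (hmk2 a))).continuousAt h1] with y' hy'
      exact (hre y').lt_iff_lt.1 (by simpa [hX y'] using hy')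
  have hy : ∃ y : ℝ, (planeExt Φ ⟨X y, y⟩).im = w.im := by
    refine mem_range_of_exists_le_of_exists_ge (f := fun y : ℝ => (planeExt Φ ⟨X y, y⟩).im)
      (Complex.continuous_im.comp (hcont.comp (hmk.comp (hXc.prodMk continuous_id))))
      ⟨w.im - C, ?_⟩ ⟨w.im + C, ?_⟩
    · have := abs_le.1 (hC ⟨X (w.im - C), w.im - C⟩).2
      simp only at this; linarith
    · have := abs_le.1 (hC ⟨X (w.im + C), w.im + C⟩).2
      simp only at this; linarith
  obtain ⟨y, hy⟩ := hy
  exact ⟨⟨X y, y⟩, Complex.ext (hX y) hy⟩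

end IsCircleLift

/-! ### Harnack-type Lipschitz bound for the plane extension -/

/-- The kernel of `planeExt` in the variable of integration on the boundary line. -/
noncomputable def planeKernel (z : ℂ) (s : ℝ) : ℂ :=
  2 / Real.pi * z.im ^ 2 *
    ((⟨z.im, s - z.re⟩ : ℂ) * (starRingEnd ℂ ⟨z.im, s - z.re⟩) ^ 2)⁻¹

/-- With s = x + ty one has y + i(s - x) = y(1 + it). Both components of the extension become one
complex integral in which z enters only through the kernel, so Φ need not be differentiated. -/
lemma im_mul_planeKernel {z : ℂ} (hz : 0 < z.im) (t : ℝ) :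
    z.im * planeKernel z (z.re + t * z.im) = (1 + t * Complex.I) * quarticKernel t := by
  have h1 : (⟨z.im, z.re + t * z.im - z.re⟩ : ℂ) = z.im * (1 + t * Complex.I) := by
    apply Complex.ext <;> simp [mul_comm]
  have h2 : (1 + t * Complex.I) * (1 - t * Complex.I) = ((1 + t ^ 2 : ℝ) : ℂ) := by
    push_cast
    linear_combination (-(t : ℂ) ^ 2) * Complex.I_sq
  have h3 : ((1 + t ^ 2 : ℝ) : ℂ) ≠ 0 := by
    rw [Complex.ofReal_ne_zero]; positivity
  have h4 : (1 + t * Complex.I) ≠ 0 := fun h => h3 (by rw [← h2, h, zero_mul])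
  have h5 : (1 - t * Complex.I) ≠ 0 := fun h => h3 (by rw [← h2, h, mul_zero])
  have h6 : (z.im : ℂ) ≠ 0 := by exact_mod_cast hz.ne'
  have h7 : (Real.pi : ℂ) ≠ 0 := by exact_mod_cast Real.pi_ne_zero
  have h8 : (quarticKernel t : ℂ) =
      2 / Real.pi * (((1 + t * Complex.I) * (1 - t * Complex.I)) ^ 2)⁻¹ := by
    rw [h2, quarticKernel]; push_cast; rfl
  rw [planeKernel, h1, h8]
  simp only [map_mul, map_add, map_one, Complex.conj_ofReal, Complex.conj_I, mul_neg,
    ← sub_eq_add_neg]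
  field_simp

/-- This controls the quotient of two plane kernels. The constant is 8 from the numerator divided by
1/8 from the denominator. -/
lemma norm_sq_div_sub_one_le {a b : ℂ} {e : ℝ} (he : e ≤ 1 / 2) (ha : ‖a - 1‖ ≤ e)
    (hb : ‖b - 1‖ ≤ e) : ‖a ^ 2 * (b * (starRingEnd ℂ b) ^ 2)⁻¹ - 1‖ ≤ 64 * e := by
  have he0 : 0 ≤ e := (norm_nonneg _).trans ha
  have hb' : ‖starRingEnd ℂ b - 1‖ ≤ e := by
    rwa [← map_one (starRingEnd ℂ), ← map_sub, Complex.norm_conj]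
  have hbl : 1 / 2 ≤ ‖b‖ := by
    have := norm_sub_norm_le 1 b
    rw [norm_one, norm_sub_rev] at this
    linarith
  have hbu : ‖b‖ ≤ 3 / 2 := by
    have := norm_add_le (b - 1) 1
    rw [sub_add_cancel, norm_one] at this
    linarith
  have hau : ‖a + 1‖ ≤ 5 / 2 := by
    have := norm_add_le (a - 1) 2
    rw [show a - 1 + 2 = a + 1 by ring, Complex.norm_ofNat] at this
    linarith
  have hbu' : ‖starRingEnd ℂ b + 1‖ ≤ 5 / 2 := by
    have := norm_add_le (starRingEnd ℂ b - 1) 2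
    rw [show starRingEnd ℂ b - 1 + 2 = starRingEnd ℂ b + 1 by ring, Complex.norm_ofNat] at this
    linarith
  have hb0 : b ≠ 0 := fun h => by rw [h, norm_zero] at hbl; linarith
  have hcb0 : starRingEnd ℂ b ≠ 0 := (map_ne_zero _).2 hb0
  have hden : 1 / 8 ≤ ‖b * (starRingEnd ℂ b) ^ 2‖ := by
    rw [norm_mul, norm_pow, Complex.norm_conj]
    calc (1 / 8 : ℝ) = 1 / 2 * (1 / 2) ^ 2 := by norm_num
      _ ≤ _ := by gcongr
  have hnum : ‖a ^ 2 - b * (starRingEnd ℂ b) ^ 2‖ ≤ 8 * e := by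
    have e1 : a ^ 2 - b * (starRingEnd ℂ b) ^ 2 = (a - 1) * (a + 1) -
        ((b - 1) * (starRingEnd ℂ b) ^ 2 + (starRingEnd ℂ b - 1) * (starRingEnd ℂ b + 1)) := by
      ring
    calc _ ≤ ‖a - 1‖ * ‖a + 1‖ + (‖b - 1‖ * ‖b‖ ^ 2 +
          ‖starRingEnd ℂ b - 1‖ * ‖starRingEnd ℂ b + 1‖) := by
          rw [e1]
          refine (norm_sub_le _ _).trans (add_le_add (norm_mul_le _ _) ((norm_add_le _ _).trans ?_))
          rw [norm_mul, norm_mul, norm_pow, Complex.norm_conj]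
      _ ≤ e * (5 / 2) + (e * (3 / 2) ^ 2 + e * (5 / 2)) := by gcongr
      _ ≤ 8 * e := by linarith
  have e2 : a ^ 2 * (b * (starRingEnd ℂ b) ^ 2)⁻¹ - 1 =
      (a ^ 2 - b * (starRingEnd ℂ b) ^ 2) / (b * (starRingEnd ℂ b) ^ 2) := by
    field_simp
  rw [e2, norm_div, div_le_iff₀ (by linarith)]
  nlinarith

/-- Moving z to w moves ζ by exactly |w - z|, while |ζ| is at least the height of z. Hence the
relative change is uniform in s. -/
lemma norm_planeKernel_sub_le {z w : ℂ} (hz : 0 < z.im) (h : ‖w - z‖ ≤ z.im / 2) (s : ℝ) :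
    ‖planeKernel w s - planeKernel z s‖ ≤ 64 * (‖w - z‖ / z.im) * ‖planeKernel z s‖ := by
  set ζ : ℂ := ⟨z.im, s - z.re⟩ with hζ
  set ζ' : ℂ := ⟨w.im, s - w.re⟩ with hζ'
  have hζn : z.im ≤ ‖ζ‖ := by
    simpa [hζ, abs_of_pos hz] using Complex.abs_re_le_norm ζ
  have hζ0 : ζ ≠ 0 := fun h0 => by rw [h0, norm_zero] at hζn; linarith
  have hcζ0 : starRingEnd ℂ ζ ≠ 0 := (map_ne_zero _).2 hζ0
  have hy0 : (z.im : ℂ) ≠ 0 := by exact_mod_cast hz.ne'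
  have hdist : ‖ζ' - ζ‖ = ‖w - z‖ := by
    rw [← sq_eq_sq₀ (norm_nonneg _) (norm_nonneg _), Complex.sq_norm, Complex.sq_norm,
      Complex.normSq_apply, Complex.normSq_apply]
    simp only [hζ, hζ', Complex.sub_re, Complex.sub_im]
    ring
  have ha : ‖(w.im / z.im : ℂ) - 1‖ ≤ ‖w - z‖ / z.im := by
    rw [div_sub_one hy0, norm_div, Complex.norm_real, Real.norm_of_nonneg hz.le,
      ← Complex.ofReal_sub, Complex.norm_real]
    gcongr
    simpa using Complex.abs_im_le_norm (w - z)
  have hb : ‖ζ' / ζ - 1‖ ≤ ‖w - z‖ / z.im := by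
    rw [div_sub_one hζ0, norm_div, hdist]
    gcongr
  have he : ‖w - z‖ / z.im ≤ 1 / 2 := by rw [div_le_iff₀ hz]; linarith
  have hbne : ζ' ≠ 0 := fun h0 => by
    rw [h0, zero_div, zero_sub, norm_neg, norm_one] at hb; linarith
  have hcbne : starRingEnd ℂ ζ' ≠ 0 := (map_ne_zero _).2 hbne
  have key := norm_sq_div_sub_one_le he ha hb
  have e1 : planeKernel w s - planeKernel z s = ((w.im / z.im : ℂ) ^ 2 *
      (ζ' / ζ * (starRingEnd ℂ (ζ' / ζ)) ^ 2)⁻¹ - 1) * planeKernel z s := by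
    rw [planeKernel, planeKernel, ← hζ, ← hζ', map_div₀]
    field_simp
  rw [e1, norm_mul]
  gcongr

lemma integral_comp_add_mul {E : Type*} [NormedAddCommGroup E] [NormedSpace ℝ E] (f : ℝ → E)
    (x : ℝ) {y : ℝ} (hy : 0 < y) : ∫ s, f s = ∫ t, y • f (x + t * y) := by
  have h := Measure.integral_comp_mul_right (fun u => f (x + u)) y
  rw [integral_add_left_eq_self f x] at h
  rw [integral_smul, h, smul_smul, abs_of_pos (inv_pos.2 hy), mul_inv_cancel₀ hy.ne', one_smul]

lemma integrable_comp_add_mul_iff {E : Type*} [NormedAddCommGroup E] [NormedSpace ℝ E] (f : ℝ → E)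
    (x : ℝ) {y : ℝ} (hy : 0 < y) :
    Integrable f ↔ Integrable fun t => y • f (x + t * y) := by
  have h1 : Integrable (fun t => y • f (x + t * y)) ↔ Integrable fun t => f (x + t * y) :=
    integrable_fun_smul_iff hy.ne' _
  rw [h1, integrable_comp_mul_right_iff (fun u => f (x + u)) hy.ne']
  exact ⟨fun h => h.comp_add_left x, fun h => by simpa using h.comp_add_left (-x)⟩

lemma smul_planeKernel {z : ℂ} (hz : 0 < z.im) (f : ℝ → ℝ) (t : ℝ) :
    z.im • ((f (z.re + t * z.im) : ℂ) * planeKernel z (z.re + t * z.im)) =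
      (f (z.re + t * z.im) * quarticKernel t : ℝ) +
        (f (z.re + t * z.im) * t * quarticKernel t : ℝ) * Complex.I := by
  rw [Complex.real_smul, mul_left_comm, im_mul_planeKernel hz]
  push_cast
  ring

lemma integrable_mul_planeKernel {f : ℝ → ℝ} {z : ℂ} (hz : 0 < z.im)
    (h1 : Integrable fun t => f (z.re + t * z.im) * quarticKernel t)
    (h2 : Integrable fun t => f (z.re + t * z.im) * t * quarticKernel t) :
    Integrable fun s => (f s : ℂ) * planeKernel z s := by
  rw [integrable_comp_add_mul_iff _ z.re hz]
  simp_rw [smul_planeKernel hz]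
  exact h1.ofReal.add (h2.ofReal.mul_const _)

lemma planeExt_eq_integral {f : ℝ → ℝ} {z : ℂ} (hz : 0 < z.im)
    (h1 : Integrable fun t => f (z.re + t * z.im) * quarticKernel t)
    (h2 : Integrable fun t => f (z.re + t * z.im) * t * quarticKernel t) :
    planeExt f z = ∫ s, (f s : ℂ) * planeKernel z s := by
  rw [integral_comp_add_mul _ z.re hz]
  simp_rw [smul_planeKernel hz]
  have h1' : Integrable fun t => ((f (z.re + t * z.im) * quarticKernel t : ℝ) : ℂ) := h1.ofReal
  have h2' : Integrable fun t =>
      ((f (z.re + t * z.im) * t * quarticKernel t : ℝ) : ℂ) * Complex.I := h2.ofReal.mul_const _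
  rw [integral_add h1' h2', integral_mul_const, integral_complex_ofReal, integral_complex_ofReal]
  exact (Complex.re_add_im (planeExt f z)).symm

lemma quarticKernel_add_le {t a : ℝ} (ha : a ^ 2 = 1) :
    quarticKernel (t + a) ≤ 9 * quarticKernel t := by
  have hπ := Real.pi_pos
  -- The difference of the two sides is ((2t + 3a)² + 1)/2.
  have h : 1 + t ^ 2 ≤ 3 * (1 + (t + a) ^ 2) := by nlinarith [sq_nonneg (2 * t + 3 * a)]
  have h2 : (1 + t ^ 2) ^ 2 ≤ 9 * (1 + (t + a) ^ 2) ^ 2 := by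
    calc (1 + t ^ 2) ^ 2 ≤ (3 * (1 + (t + a) ^ 2)) ^ 2 := by gcongr
      _ = _ := by ring
  have h3 : ((1 + (t + a) ^ 2) ^ 2)⁻¹ ≤ 9 * ((1 + t ^ 2) ^ 2)⁻¹ := by
    rw [← div_eq_mul_inv, inv_eq_one_div, div_le_div_iff₀ (by positivity) (by positivity)]
    linarith
  unfold quarticKernel
  calc _ ≤ 2 / Real.pi * (9 * ((1 + t ^ 2) ^ 2)⁻¹) := by gcongr
    _ = _ := by ring

namespace IsCircleLift

variable {Φ : ℝ → ℝ}

lemma integrable_sub_mul (hΦ : IsCircleLift Φ) (x y c : ℝ) :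
    Integrable (fun t => (Φ (x + t * y) - c) * quarticKernel t) ∧
      Integrable fun t => (Φ (x + t * y) - c) * t * quarticKernel t := by
  obtain ⟨h1, h2⟩ := hΦ.integrable_mul_pow x y
  constructor
  · simp_rw [sub_mul]
    exact h1.sub (integrable_quarticKernel.const_mul c)
  · simp_rw [sub_mul, mul_assoc c]
    exact h2.sub (integrable_id_mul_quarticKernel.const_mul c)

lemma planeExt_sub_const (hΦ : IsCircleLift Φ) (c : ℝ) (z : ℂ) :
    planeExt (fun s => Φ s - c) z = planeExt Φ z - c := by
  obtain ⟨h1, h2⟩ := hΦ.integrable_mul_pow z.re z.im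
  apply Complex.ext
  · simp only [planeExt, Complex.sub_re, Complex.ofReal_re, sub_mul]
    rw [integral_sub h1 (integrable_quarticKernel.const_mul c), integral_const_mul,
      integral_quarticKernel, mul_one]
  · simp only [planeExt, Complex.sub_im, Complex.ofReal_im, sub_mul, mul_assoc c]
    rw [integral_sub h2 (integrable_id_mul_quarticKernel.const_mul c), integral_const_mul,
      integral_id_mul_quarticKernel, mul_zero]

/-- The first moment vanishes, so the constant Φ(x) may be subtracted; then the increment of Φ has
the sign of t. -/
lemma planeExt_im_eq_integral_abs (hΦ : IsCircleLift Φ) {z : ℂ} (hz : 0 < z.im) :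
    (planeExt Φ z).im =
      ∫ t, |Φ (z.re + t * z.im) - Φ z.re| * |t| * quarticKernel t := by
  have h := congrArg Complex.im (hΦ.planeExt_sub_const (Φ z.re) z)
  simp only [planeExt, Complex.sub_im, Complex.ofReal_im, sub_zero] at h
  refine h.symm.trans (integral_congr_ae (.of_forall fun t => ?_))
  simp only
  rw [← abs_mul, abs_of_nonneg]
  rcases le_total 0 t with ht | ht
  · refine mul_nonneg (sub_nonneg.2 (hΦ.strictMono.monotone ?_)) ht
    nlinarith
  · refine mul_nonneg_of_nonpos_of_nonpos (sub_nonpos.2 (hΦ.strictMono.monotone ?_)) ht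
    nlinarith

/-- The mean oscillation of the boundary function is controlled by the height of the image. -/
lemma integral_abs_sub_le (hΦ : IsCircleLift Φ) {z : ℂ} (hz : 0 < z.im) :
    ∫ t, |Φ (z.re + t * z.im) - Φ z.re| * quarticKernel t ≤ 18 * (planeExt Φ z).im := by
  set f : ℝ → ℝ := fun t => |Φ (z.re + t * z.im) - Φ z.re| with hf
  have hmono : ∀ a b : ℝ, 0 ≤ a → a ≤ b → f a ≤ f b := fun a b ha hab => by
    have h1 : Φ z.re ≤ Φ (z.re + a * z.im) := hΦ.strictMono.monotone (by nlinarith)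
    have h2 : Φ (z.re + a * z.im) ≤ Φ (z.re + b * z.im) := hΦ.strictMono.monotone (by nlinarith)
    simp only [hf]
    rw [abs_of_nonneg (by linarith), abs_of_nonneg (by linarith)]
    linarith
  have hanti : ∀ a b : ℝ, a ≤ 0 → b ≤ a → f a ≤ f b := fun a b ha hab => by
    have h1 : Φ (z.re + a * z.im) ≤ Φ z.re := hΦ.strictMono.monotone (by nlinarith)
    have h2 : Φ (z.re + b * z.im) ≤ Φ (z.re + a * z.im) := hΦ.strictMono.monotone (by nlinarith)
    simp only [hf]
    rw [abs_of_nonpos (by linarith), abs_of_nonpos (by linarith)]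
    linarith
  have hf0 : ∀ t, 0 ≤ f t := fun t => abs_nonneg _
  obtain ⟨i1, i2⟩ := hΦ.integrable_sub_mul z.re z.im (Φ z.re)
  have j1 : Integrable fun t => f t * quarticKernel t := by
    refine i1.norm.congr (.of_forall fun t => ?_)
    simp [hf, abs_of_pos (quarticKernel_pos t)]
  have j2 : Integrable fun t => f t * |t| * quarticKernel t := by
    refine i2.norm.congr (.of_forall fun t => ?_)
    simp [hf, abs_of_pos (quarticKernel_pos t)]
  have hcf : Continuous f := ((hΦ.continuous_line z.re z.im).sub continuous_const).abs
  -- The height carries an extra weight |t|, which is small near 0. Since f grows away from 0, f(t)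
  -- is at most f(t ± 1)|t ± 1| with the sign of t. Each shift costs a factor 9, whence 18.
  have shift : ∀ a : ℝ, a ^ 2 = 1 →
      Integrable (fun t => f (t + a) * |t + a| * quarticKernel t) ∧
      ∫ t, f (t + a) * |t + a| * quarticKernel t ≤ 9 * (planeExt Φ z).im := fun a ha => by
    have ha' : (-a) ^ 2 = 1 := by rw [neg_sq, ha]
    have k1 : Integrable fun t => f t * |t| * quarticKernel (t + -a) := by
      refine (j2.const_mul 9).mono' ?_ (.of_forall fun t => ?_)
      · have := continuous_quarticKernel
        exact Continuous.aestronglyMeasurable (by fun_prop)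
      · have h0 := mul_nonneg (hf0 t) (abs_nonneg t)
        rw [Real.norm_of_nonneg (mul_nonneg h0 (quarticKernel_pos _).le)]
        nlinarith [mul_le_mul_of_nonneg_left (quarticKernel_add_le (t := t) ha') h0]
    have k2 := k1.comp_add_right a
    simp only [add_neg_cancel_right] at k2
    refine ⟨k2, ?_⟩
    have k3 := integral_add_right_eq_self (μ := volume) (fun t => f t * |t| * quarticKernel (t + -a)) a
    simp only [add_neg_cancel_right] at k3
    rw [k3, hΦ.planeExt_im_eq_integral_abs hz, ← integral_const_mul]
    refine integral_mono k1 (j2.const_mul 9) fun t => ?_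
    have h0 := mul_nonneg (hf0 t) (abs_nonneg t)
    have := mul_le_mul_of_nonneg_left (quarticKernel_add_le (t := t) ha') h0
    simp only [hf] at this ⊢
    linarith
  obtain ⟨a1, a2⟩ := shift 1 (by norm_num)
  obtain ⟨b1, b2⟩ := shift (-1) (by norm_num)
  calc _ ≤ ∫ t, (f (t + 1) * |t + 1| * quarticKernel t +
        f (t + -1) * |t + -1| * quarticKernel t) := by
        refine integral_mono j1 (a1.add b1) fun t => ?_
        simp only [← add_mul]
        refine mul_le_mul_of_nonneg_right ?_ (quarticKernel_pos t).le
        rcases le_total 0 t with ht | ht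
        · have h1 := hmono t (t + 1) ht (by linarith)
          have h2 : 1 ≤ |t + 1| := by rw [abs_of_nonneg (by linarith)]; linarith
          have h3 := mul_nonneg (hf0 (t + -1)) (abs_nonneg (t + -1))
          nlinarith [hf0 (t + 1)]
        · have h1 := hanti t (t + -1) ht (by linarith)
          have h2 : 1 ≤ |t + -1| := by rw [abs_of_nonpos (by linarith)]; linarith
          have h3 := mul_nonneg (hf0 (t + 1)) (abs_nonneg (t + 1))
          nlinarith [hf0 (t + -1)]
    _ ≤ _ := by rw [integral_add a1 b1]; linarith

/-- After subtracting Φ(x), the relative kernel bound reduces the claim to an absolute integral. As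
|1 + it| ≤ 1 + |t|, that integral is at most 18 + 1 times the height of the image, and 1216 = 64 ·
19. -/
lemma norm_planeExt_sub_le (hΦ : IsCircleLift Φ) {z w : ℂ} (hz : 0 < z.im)
    (h : ‖w - z‖ ≤ z.im / 2) :
    ‖planeExt Φ w - planeExt Φ z‖ ≤ 1216 * ((planeExt Φ z).im / z.im) * ‖w - z‖ := by
  have hw : 0 < w.im := by
    have h1 := (abs_le.1 ((Complex.abs_im_le_norm (w - z)).trans h)).1
    rw [Complex.sub_im] at h1
    linarith
  set f : ℝ → ℝ := fun s => Φ s - Φ z.re with hf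
  obtain ⟨iz1, iz2⟩ := hΦ.integrable_sub_mul z.re z.im (Φ z.re)
  obtain ⟨iw1, iw2⟩ := hΦ.integrable_sub_mul w.re w.im (Φ z.re)
  have jz : Integrable fun s => (f s : ℂ) * planeKernel z s := integrable_mul_planeKernel hz iz1 iz2
  have jw : Integrable fun s => (f s : ℂ) * planeKernel w s := integrable_mul_planeKernel hw iw1 iw2
  have e1 : planeExt Φ w - planeExt Φ z =
      ∫ s, ((f s : ℂ) * planeKernel w s - (f s : ℂ) * planeKernel z s) := by
    rw [integral_sub jw jz, ← planeExt_eq_integral (f := f) hw iw1 iw2,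
      ← planeExt_eq_integral (f := f) hz iz1 iz2, hΦ.planeExt_sub_const, hΦ.planeExt_sub_const]
    ring
  have j1 : Integrable fun t => |f (z.re + t * z.im)| * quarticKernel t := by
    refine iz1.norm.congr (.of_forall fun t => ?_)
    simp [hf, abs_of_pos (quarticKernel_pos t)]
  have j2 : Integrable fun t => |f (z.re + t * z.im)| * |t| * quarticKernel t := by
    refine iz2.norm.congr (.of_forall fun t => ?_)
    simp [hf, abs_of_pos (quarticKernel_pos t)]
  have e2 : ∫ s, ‖(f s : ℂ) * planeKernel z s‖ ≤ 19 * (planeExt Φ z).im := by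
    rw [integral_comp_add_mul _ z.re hz]
    calc _ ≤ ∫ t, (|f (z.re + t * z.im)| * quarticKernel t +
          |f (z.re + t * z.im)| * |t| * quarticKernel t) := by
          refine integral_mono ?_ (j1.add j2) fun t => ?_
          · exact (integrable_comp_add_mul_iff _ z.re hz).1 jz.norm
          · have hk : z.im * ‖planeKernel z (z.re + t * z.im)‖ =
                ‖1 + t * Complex.I‖ * quarticKernel t := by
              have := congrArg norm (im_mul_planeKernel hz t)
              rwa [norm_mul, norm_mul, Complex.norm_real, Complex.norm_real,
                Real.norm_of_nonneg hz.le, Real.norm_of_nonneg (quarticKernel_pos t).le] at this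
            have hn : ‖1 + t * Complex.I‖ ≤ 1 + |t| := by
              refine (norm_add_le _ _).trans ?_
              simp
            simp only [smul_eq_mul, norm_mul, Complex.norm_real, Real.norm_eq_abs]
            rw [mul_left_comm, hk]
            calc _ ≤ |f (z.re + t * z.im)| * ((1 + |t|) * quarticKernel t) := by
                  have := (quarticKernel_pos t).le
                  gcongr
              _ = _ := by ring
      _ ≤ _ := by
          rw [integral_add j1 j2, ← hΦ.planeExt_im_eq_integral_abs hz]
          linarith [hΦ.integral_abs_sub_le hz]
  rw [e1]
  calc _ ≤ ∫ s, 64 * (‖w - z‖ / z.im) * ‖(f s : ℂ) * planeKernel z s‖ := by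
        refine norm_integral_le_of_norm_le (jz.norm.const_mul _) (.of_forall fun s => ?_)
        rw [← mul_sub, norm_mul, norm_mul, mul_left_comm]
        gcongr
        exact norm_planeKernel_sub_le hz h s
    _ ≤ 64 * (‖w - z‖ / z.im) * (19 * (planeExt Φ z).im) := by
        rw [integral_const_mul]
        gcongr
    _ = _ := by ring

end IsCircleLift

/-! ### Descent to the disk -/

/-- The map induced by `planeExt` on the punctured plane by the covering `z ↦ exp (i z)`, completed
by `0 ↦ 0`. -/
noncomputable def discExt (Φ : ℝ → ℝ) (w : ℂ) : ℂ :=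
  if w = 0 then 0 else Complex.exp (Complex.I * planeExt Φ (-Complex.I * Complex.log w))

lemma discExt_zero (Φ : ℝ → ℝ) : discExt Φ 0 = 0 := if_pos rfl

lemma norm_exp_I_mul (z : ℂ) : ‖Complex.exp (Complex.I * z)‖ = Real.exp (-z.im) := by
  simp [Complex.norm_exp]

lemma exists_exp_I_mul_eq {w : ℂ} (hw : w ≠ 0) : ∃ z, Complex.exp (Complex.I * z) = w := by
  refine ⟨-Complex.I * Complex.log w, ?_⟩
  rw [← mul_assoc, mul_neg, Complex.I_mul_I, neg_neg, one_mul, Complex.exp_log hw]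

lemma exp_I_mul_eq_iff {z w : ℂ} : Complex.exp (Complex.I * z) = Complex.exp (Complex.I * w) ↔
    ∃ n : ℤ, z = w + n * (2 * Real.pi) := by
  rw [Complex.exp_eq_exp_iff_exists_int]
  refine exists_congr fun n => ⟨fun h => ?_, fun h => ?_⟩
  · linear_combination (-Complex.I) * h + (z - w - n * (2 * Real.pi)) * Complex.I_sq
  · rw [h]; ring

namespace IsCircleLift

variable {Φ : ℝ → ℝ}

/-- Commutation with translations by 2π makes the choice of logarithm immaterial. -/
lemma discExt_exp (hΦ : IsCircleLift Φ) (z : ℂ) :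
    discExt Φ (Complex.exp (Complex.I * z)) = Complex.exp (Complex.I * planeExt Φ z) := by
  rw [discExt, if_neg (Complex.exp_ne_zero _), exp_I_mul_eq_iff]
  have h : Complex.exp (Complex.I * (-Complex.I * Complex.log (Complex.exp (Complex.I * z)))) =
      Complex.exp (Complex.I * z) := by
    rw [← mul_assoc, mul_neg, Complex.I_mul_I, neg_neg, one_mul,
      Complex.exp_log (Complex.exp_ne_zero _)]
  obtain ⟨n, hn⟩ := exp_I_mul_eq_iff.1 h
  exact ⟨n, by rw [hn, hΦ.planeExt_add_int_mul]⟩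

lemma discExt_ne_zero (hΦ : IsCircleLift Φ) {w : ℂ} (hw : w ≠ 0) : discExt Φ w ≠ 0 := by
  obtain ⟨z, rfl⟩ := exists_exp_I_mul_eq hw
  rw [hΦ.discExt_exp]
  exact Complex.exp_ne_zero _

lemma discExt_injective (hΦ : IsCircleLift Φ) : Function.Injective (discExt Φ) := by
  intro a b h
  by_cases ha : a = 0
  · by_contra hab
    rw [ha, discExt_zero] at h
    exact hΦ.discExt_ne_zero (fun hb => hab (by rw [ha, hb])) h.symm
  · by_cases hb : b = 0
    · rw [hb, discExt_zero] at h
      exact absurd h (hΦ.discExt_ne_zero ha)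
    · obtain ⟨z, rfl⟩ := exists_exp_I_mul_eq ha
      obtain ⟨w, rfl⟩ := exists_exp_I_mul_eq hb
      rw [hΦ.discExt_exp, hΦ.discExt_exp, exp_I_mul_eq_iff] at h
      obtain ⟨n, hn⟩ := h
      rw [← hΦ.planeExt_add_int_mul] at hn
      exact exp_I_mul_eq_iff.2 ⟨n, hΦ.planeExt_injective hn⟩

lemma discExt_surjective (hΦ : IsCircleLift Φ) : Function.Surjective (discExt Φ) := by
  intro a
  by_cases ha : a = 0
  · exact ⟨0, by rw [ha, discExt_zero]⟩
  · obtain ⟨w, rfl⟩ := exists_exp_I_mul_eq ha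
    obtain ⟨z, rfl⟩ := hΦ.planeExt_surjective w
    exact ⟨_, hΦ.discExt_exp z⟩

lemma norm_discExt_le_one_iff (hΦ : IsCircleLift Φ) (w : ℂ) : ‖discExt Φ w‖ ≤ 1 ↔ ‖w‖ ≤ 1 := by
  by_cases hw : w = 0
  · simp [hw, discExt_zero]
  · obtain ⟨z, rfl⟩ := exists_exp_I_mul_eq hw
    rw [hΦ.discExt_exp, norm_exp_I_mul, norm_exp_I_mul, Real.exp_le_one_iff, Real.exp_le_one_iff,
      Left.neg_nonpos_iff, Left.neg_nonpos_iff, ← not_lt, ← not_lt, hΦ.planeExt_im_neg_iff]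

lemma discExt_exp_ofReal (hΦ : IsCircleLift Φ) (t : ℝ) :
    discExt Φ (Complex.exp (Complex.I * t)) = Complex.exp (Complex.I * Φ t) := by
  rw [hΦ.discExt_exp, planeExt_ofReal]

lemma exists_norm_discExt_le (hΦ : IsCircleLift Φ) :
    ∃ C, 0 < C ∧ ∀ w, ‖discExt Φ w‖ ≤ C * ‖w‖ := by
  obtain ⟨C, hC0, hC⟩ := hΦ.exists_abs_planeExt_sub_le
  refine ⟨Real.exp C, Real.exp_pos C, fun w => ?_⟩
  by_cases hw : w = 0
  · simp [hw, discExt_zero]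
  · obtain ⟨z, rfl⟩ := exists_exp_I_mul_eq hw
    rw [hΦ.discExt_exp, norm_exp_I_mul, norm_exp_I_mul, ← Real.exp_add, Real.exp_le_exp]
    linarith [(abs_le.1 (hC z).2).1]

lemma continuous_discExt (hΦ : IsCircleLift Φ) : Continuous (discExt Φ) := by
  refine continuous_iff_continuousAt.2 fun a => ?_
  by_cases ha : a = 0
  · obtain ⟨C, hC0, hC⟩ := hΦ.exists_norm_discExt_le
    rw [ha, ContinuousAt, discExt_zero]
    refine squeeze_zero_norm hC ?_
    have : Continuous fun w : ℂ => C * ‖w‖ := by fun_prop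
    simpa using this.tendsto 0
  · obtain ⟨z, rfl⟩ := exists_exp_I_mul_eq ha
    set a := Complex.exp (Complex.I * z) with haz
    -- The logarithm is centred at a, because a itself may lie on the branch cut.
    have h1 : ContinuousAt (fun w => Complex.exp (Complex.I *
        planeExt Φ (z - Complex.I * Complex.log (w / a)))) a := by
      have hl : ContinuousAt (fun w => Complex.log (w / a)) a := by
        refine ContinuousAt.clog (by fun_prop) ?_
        rw [div_self ha]
        exact Complex.one_mem_slitPlane
      have hF := hΦ.continuous_planeExt.continuousAt
        (x := z - Complex.I * Complex.log (a / a))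
      exact (continuousAt_const.mul (ContinuousAt.comp (f := fun w => z - Complex.I *
        Complex.log (w / a)) hF (continuousAt_const.sub (continuousAt_const.mul hl)))).cexp
    refine h1.congr ?_
    filter_upwards [isOpen_ne.mem_nhds ha] with w hw
    rw [← hΦ.discExt_exp]
    congr 1
    have : Complex.I * (z - Complex.I * Complex.log (w / a)) =
        Complex.I * z + Complex.log (w / a) := by
      linear_combination (-Complex.log (w / a)) * Complex.I_sq
    rw [this, Complex.exp_add, Complex.exp_log (div_ne_zero hw ha), ← haz, mul_div_cancel₀ _ ha]

lemma exists_planeExt_im_le (hΦ : IsCircleLift Φ) :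
    ∃ C, 0 < C ∧ ∀ z, (planeExt Φ z).im ≤ z.im + C ∧ z.im - C ≤ (planeExt Φ z).im := by
  obtain ⟨C, hC0, hC⟩ := hΦ.exists_abs_planeExt_sub_le
  exact ⟨C, hC0, fun z => by constructor <;> linarith [abs_le.1 (hC z).2]⟩

/-- The local Lipschitz constant of the extension at a point of the disk is controlled by the
quotient of the heights of the image and of the point. -/
lemma exists_norm_discExt_sub_le (hΦ : IsCircleLift Φ) :
    ∃ C, 0 < C ∧ ∀ z, 0 < z.im → ∀ w, ‖w - Complex.exp (Complex.I * z)‖ ≤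
      ‖Complex.exp (Complex.I * z)‖ * (min 1 z.im / 4) →
      ‖discExt Φ w - discExt Φ (Complex.exp (Complex.I * z))‖ ≤
        C * ((planeExt Φ z).im / z.im) * ‖w - Complex.exp (Complex.I * z)‖ := by
  obtain ⟨C, hC0, hC⟩ := hΦ.exists_planeExt_im_le
  -- Here 1824 = 1216 · 3/2, the 3/2 coming from log(1 + u), and 456 = 1824/4. The exponential
  -- absorbs exp ‖D‖ and the ratio exp(-V)/|a|.
  refine ⟨1824 * Real.exp (456 * (1 + C) + C), by positivity, fun z hz w hw => ?_⟩
  set a := Complex.exp (Complex.I * z) with ha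
  have ha0 : a ≠ 0 := Complex.exp_ne_zero _
  have han : 0 < ‖a‖ := norm_pos_iff.2 ha0
  set V := (planeExt Φ z).im with hV
  have hVpos : 0 < V := (hΦ.planeExt_im_pos_iff z).2 hz
  set u := (w - a) / a with hu
  have hun : ‖u‖ = ‖w - a‖ / ‖a‖ := norm_div _ _
  have hum : ‖u‖ ≤ min 1 z.im / 4 := by rw [hun, div_le_iff₀ han]; linarith
  have hm1 := min_le_left 1 z.im
  have hm2 := min_le_right 1 z.im
  have hm0 : 0 < min 1 z.im := lt_min one_pos hz
  have hlog := Complex.norm_log_one_add_half_le_self (z := u) (by linarith)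
  have h1u : 1 + u ≠ 0 := fun h => by
    have : ‖u‖ = 1 := by rw [eq_neg_of_add_eq_zero_right h, norm_neg, norm_one]
    linarith
  set δ := -Complex.I * Complex.log (1 + u) with hδ
  have hδn : ‖δ‖ ≤ 3 / 2 * ‖u‖ := by
    rw [hδ, norm_mul, norm_neg, Complex.norm_I, one_mul]
    exact hlog
  have hwexp : w = Complex.exp (Complex.I * (z + δ)) := by
    have : Complex.I * (z + δ) = Complex.I * z + Complex.log (1 + u) := by
      rw [hδ]; linear_combination (-Complex.log (1 + u)) * Complex.I_sq
    rw [this, Complex.exp_add, Complex.exp_log h1u, ← ha, hu]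
    field_simp
    ring
  set D := planeExt Φ (z + δ) - planeExt Φ z with hD
  have hDn : ‖D‖ ≤ 1216 * (V / z.im) * ‖δ‖ := by
    have := hΦ.norm_planeExt_sub_le (z := z) (w := z + δ) hz
      (by rw [add_sub_cancel_left]; linarith)
    rwa [add_sub_cancel_left] at this
  have hVm : V / z.im * min 1 z.im ≤ 1 + C := by
    rw [div_mul_eq_mul_div, div_le_iff₀ hz]
    have := (hC z).1
    rcases le_total 1 z.im with h | h
    · rw [min_eq_left h]; nlinarith
    · rw [min_eq_right h]; nlinarith
  have hDM : ‖D‖ ≤ 456 * (1 + C) := by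
    calc ‖D‖ ≤ 1216 * (V / z.im) * ‖δ‖ := hDn
      _ ≤ 1216 * (V / z.im) * (3 / 2 * (min 1 z.im / 4)) := by
          have := hδn.trans (mul_le_mul_of_nonneg_left hum (by norm_num : (0 : ℝ) ≤ 3 / 2))
          gcongr
      _ = 456 * (V / z.im * min 1 z.im) := by ring
      _ ≤ _ := by gcongr
  have hexp : ‖Complex.exp (Complex.I * D) - 1‖ ≤ ‖D‖ * Real.exp ‖D‖ := by
    have := Complex.norm_exp_sub_sum_le_norm_mul_exp (Complex.I * D) 1
    simpa using this
  have hfac : discExt Φ w - discExt Φ a =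
      Complex.exp (Complex.I * planeExt Φ z) * (Complex.exp (Complex.I * D) - 1) := by
    rw [hwexp, ha, hΦ.discExt_exp, hΦ.discExt_exp, mul_sub, mul_one, ← Complex.exp_add, hD]
    congr 3
    ring
  have hratio : Real.exp (-V) / ‖a‖ ≤ Real.exp C := by
    rw [ha, norm_exp_I_mul, ← Real.exp_sub, Real.exp_le_exp]
    linarith [(hC z).2]
  rw [hfac, norm_mul, norm_exp_I_mul, ← hV]
  calc Real.exp (-V) * ‖Complex.exp (Complex.I * D) - 1‖
      ≤ Real.exp (-V) * (1216 * (V / z.im) * (3 / 2 * (‖w - a‖ / ‖a‖)) *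
        Real.exp (456 * (1 + C))) := by
        rw [← hun]
        gcongr
        refine hexp.trans ?_
        gcongr
        exact hDn.trans (by gcongr)
    _ = (Real.exp (-V) / ‖a‖) * (1824 * Real.exp (456 * (1 + C)) * (V / z.im) * ‖w - a‖) := by
        ring
    _ ≤ Real.exp C * (1824 * Real.exp (456 * (1 + C)) * (V / z.im) * ‖w - a‖) := by
        gcongr
    _ = _ := by rw [Real.exp_add]; ring

/-- If |x - y| is small relative to |y|, the pointwise estimate applies, with heights bounded below
by -log r. Otherwise |x| and |y| are bounded by multiples of |x - y|, and the linear bound at the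
origin suffices. -/
lemma exists_lipschitzOnWith_discExt (hΦ : IsCircleLift Φ) {r : ℝ} (hr0 : 0 < r) (hr1 : r < 1) :
    ∃ K, LipschitzOnWith K (discExt Φ) (ball 0 r) := by
  obtain ⟨C, hC0, hC⟩ := hΦ.exists_norm_discExt_le
  obtain ⟨A, hA0, hA⟩ := hΦ.exists_norm_discExt_sub_le
  obtain ⟨B, hB0, hB⟩ := hΦ.exists_planeExt_im_le
  set l := -Real.log r with hl
  have hl0 : 0 < l := by rw [hl, neg_pos]; exact Real.log_neg hr0 hr1
  set c := min 1 l / 4 with hc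
  have hc0 : 0 < c := by positivity
  set K := max (A * (1 + B / l)) (C * (1 + 2 / c)) with hK
  have hK0 : 0 ≤ K := le_max_of_le_right (by positivity)
  refine ⟨K.toNNReal, LipschitzOnWith.of_dist_le_mul fun x hx y hy => ?_⟩
  rw [Real.coe_toNNReal _ hK0, dist_eq_norm, dist_eq_norm]
  by_cases hsmall : ‖x - y‖ ≤ ‖y‖ * c
  · by_cases hy0 : y = 0
    · have hx0 : x = y := by
        rw [hy0, norm_zero, zero_mul] at hsmall
        rw [← sub_eq_zero, ← norm_le_zero_iff, hy0]; exact hsmall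
      simp [hx0]
    · obtain ⟨z, rfl⟩ := exists_exp_I_mul_eq hy0
      have hzl : l ≤ z.im := by
        rw [mem_ball_zero_iff, norm_exp_I_mul, ← Real.lt_log_iff_exp_lt hr0] at hy
        rw [hl]; linarith
      have hz0 : 0 < z.im := hl0.trans_le hzl
      have h1 := hA z hz0 x (hsmall.trans (by rw [hc]; gcongr))
      refine h1.trans (mul_le_mul_of_nonneg_right (le_trans ?_ (le_max_left _ _)) (norm_nonneg _))
      have h2 : (planeExt Φ z).im / z.im ≤ 1 + B / l := by
        calc (planeExt Φ z).im / z.im ≤ (z.im + B) / z.im := by gcongr; exact (hB z).1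
          _ = 1 + B / z.im := by rw [add_div, div_self hz0.ne']
          _ ≤ _ := by gcongr
      gcongr
  · push Not at hsmall
    have h1 : ‖y‖ ≤ ‖x - y‖ / c := by rw [le_div_iff₀ hc0]; exact hsmall.le
    have h2 : ‖x‖ ≤ ‖x - y‖ + ‖y‖ := by simpa using norm_add_le (x - y) y
    calc _ ≤ ‖discExt Φ x‖ + ‖discExt Φ y‖ := norm_sub_le _ _
      _ ≤ C * ‖x‖ + C * ‖y‖ := add_le_add (hC x) (hC y)
      _ = C * (‖x‖ + ‖y‖) := by ring
      _ ≤ C * (‖x - y‖ + 2 * (‖x - y‖ / c)) :=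
          mul_le_mul_of_nonneg_left (by linarith) hC0.le
      _ = C * (1 + 2 / c) * ‖x - y‖ := by ring
      _ ≤ _ := by gcongr; exact le_max_right _ _

lemma locallyLipschitzOn_discExt (hΦ : IsCircleLift Φ) :
    LocallyLipschitzOn (ball (0 : ℂ) 1) (discExt Φ) := by
  intro x hx
  rw [mem_ball_zero_iff] at hx
  obtain ⟨r, hr, hr1⟩ := exists_between hx
  obtain ⟨K, hK⟩ := hΦ.exists_lipschitzOnWith_discExt ((norm_nonneg x).trans_lt hr) hr1
  exact ⟨K, _, mem_nhdsWithin_of_mem_nhds (isOpen_ball.mem_nhds (by simpa using hr)), hK⟩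

lemma exists_norm_fderiv_discExt_le (hΦ : IsCircleLift Φ) :
    ∃ C, 0 < C ∧ ∀ z, 0 < z.im → ‖fderiv ℝ (discExt Φ) (Complex.exp (Complex.I * z))‖ ≤
      C * ((planeExt Φ z).im / z.im) := by
  obtain ⟨C, hC0, hC⟩ := hΦ.exists_norm_discExt_sub_le
  refine ⟨C, hC0, fun z hz => ?_⟩
  have hV := (hΦ.planeExt_im_pos_iff z).2 hz
  have hpos : 0 < ‖Complex.exp (Complex.I * z)‖ * (min 1 z.im / 4) := by
    have : 0 < min 1 z.im := lt_min one_pos hz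
    have := norm_pos_iff.2 (Complex.exp_ne_zero (Complex.I * z))
    positivity
  refine norm_fderiv_le_of_lip' ℝ (by positivity) ?_
  filter_upwards [Metric.closedBall_mem_nhds _ hpos] with w hw
  exact hC z hz w (by rwa [mem_closedBall, dist_eq_norm] at hw)

end IsCircleLift

/-! ### Energy estimate -/

/-- Pointwise bound for the energy density in terms of the height `y` of a point, the height `v` of
its image and a bound `c * (v / y)` for the derivative. -/
lemma exists_density_le {p q c B : ℝ} (hp₁ : 1 ≤ p) (hq : q < 1) (hc : 0 < c) (hB : 0 < B) :
    ∃ M, 0 < M ∧ ∀ v y n : ℝ, 0 < v → 0 < y → v ≤ y + B → 0 ≤ n → n ≤ c * (v / y) →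
      n ^ p / (1 - Real.exp (-v)) ^ q ≤
        M * (1 + y ^ (min (p - max q 0) 1 - p) * (1 + v / y)) := by
  -- Negative q is replaced by 0, as the base 1 - exp(-v) is below 1. The exponent s ≤ 1 makes
  -- (v/y)^s at most 1 + v/y, and s ≤ p - q₀ keeps the remaining power of v bounded when y ≤ 1.
  set q₀ := max q 0 with hq₀
  set s := min (p - q₀) 1 with hs
  set D := 1 + B with hD
  have hq0 : 0 ≤ q₀ := le_max_right _ _
  have hq1 : q₀ < 1 := max_lt hq one_pos
  have hs0 : 0 < s := lt_min (by linarith) one_pos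
  have hs1 : s ≤ 1 := min_le_right _ _
  have hsp : s ≤ p - q₀ := min_le_left _ _
  refine ⟨c ^ p * (D ^ (p - q₀) * (1 + D) ^ q₀ + (1 + D) ^ q₀ * D ^ (p - q₀ - s)), by positivity,
    fun v y n hv hy hvy hn0 hn => ?_⟩
  have hex : v / (1 + v) ≤ 1 - Real.exp (-v) := by
    have h1 : Real.exp (-v) ≤ (1 + v)⁻¹ := by
      rw [Real.exp_neg]
      exact inv_anti₀ (by positivity) (by linarith [Real.add_one_le_exp v])
    have h2 : v / (1 + v) = 1 - (1 + v)⁻¹ := by field_simp; ring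
    linarith
  have hex0 : 0 < 1 - Real.exp (-v) := lt_of_lt_of_le (by positivity) hex
  have hden : (v / (1 + v)) ^ q₀ ≤ (1 - Real.exp (-v)) ^ q :=
    (Real.rpow_le_rpow (by positivity) hex hq0).trans
      (Real.rpow_le_rpow_of_exponent_ge hex0 (by linarith [Real.exp_pos (-v)]) (le_max_left _ _))
  have hmain : n ^ p / (1 - Real.exp (-v)) ^ q ≤
      c ^ p * (v ^ (p - q₀) * (1 + v) ^ q₀ * y ^ (-p)) := by
    calc _ ≤ (c * (v / y)) ^ p / (v / (1 + v)) ^ q₀ :=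
          div_le_div₀ (by positivity) (Real.rpow_le_rpow hn0 hn (by linarith)) (by positivity) hden
      _ = _ := by
        rw [Real.mul_rpow hc.le (by positivity), Real.div_rpow hv.le hy.le,
          Real.div_rpow hv.le (by positivity), Real.rpow_sub hv, Real.rpow_neg hy.le]
        field_simp
  refine hmain.trans ?_
  rw [mul_assoc (c ^ p)]
  refine mul_le_mul_of_nonneg_left ?_ (Real.rpow_nonneg hc.le p)
  set X := y ^ (s - p) * (1 + v / y) with hX
  have hX0 : 0 ≤ X := by positivity
  set M₁ := D ^ (p - q₀) * (1 + D) ^ q₀ with hM₁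
  set M₂ := (1 + D) ^ q₀ * D ^ (p - q₀ - s) with hM₂
  have hM₁0 : 0 ≤ M₁ := by positivity
  have hM₂0 : 0 ≤ M₂ := by positivity
  have hpq : 0 ≤ p - q₀ := by linarith
  rcases le_total 1 y with h | h
  · have h1 : v / y ≤ D := by rw [div_le_iff₀ hy]; nlinarith
    have h2 : (1 + v) / y ≤ 1 + D := by rw [div_le_iff₀ hy]; nlinarith
    have h3 : v ^ (p - q₀) * (1 + v) ^ q₀ * y ^ (-p) = (v / y) ^ (p - q₀) * ((1 + v) / y) ^ q₀ := by
      rw [Real.div_rpow hv.le hy.le, Real.div_rpow (by positivity) hy.le, Real.rpow_neg hy.le,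
        Real.rpow_sub hy]
      field_simp
    have h4 : (v / y) ^ (p - q₀) * ((1 + v) / y) ^ q₀ ≤ M₁ := by
      rw [hM₁]; gcongr
    rw [h3]
    nlinarith [mul_nonneg hM₁0 hX0, mul_nonneg hM₂0 hX0]
  · have h1 : v ≤ D := by linarith
    have h2 : v ^ (p - q₀) = v ^ s * v ^ (p - q₀ - s) := by
      rw [← Real.rpow_add hv]; congr 1; ring
    have h3 : v ^ s * y ^ (-p) = y ^ (s - p) * (v / y) ^ s := by
      rw [Real.div_rpow hv.le hy.le, Real.rpow_sub hy, Real.rpow_neg hy.le]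
      field_simp
    have h4 : (v / y) ^ s ≤ 1 + v / y := by
      calc (v / y) ^ s ≤ (1 + v / y) ^ s := by gcongr; linarith
        _ ≤ (1 + v / y) ^ (1 : ℝ) :=
          Real.rpow_le_rpow_of_exponent_le (by linarith [div_pos hv hy]) hs1
        _ = _ := Real.rpow_one _
    have h5 : v ^ (p - q₀ - s) ≤ D ^ (p - q₀ - s) :=
      Real.rpow_le_rpow hv.le h1 (by linarith)
    calc v ^ (p - q₀) * (1 + v) ^ q₀ * y ^ (-p)
        = (1 + v) ^ q₀ * v ^ (p - q₀ - s) * (v ^ s * y ^ (-p)) := by rw [h2]; ring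
      _ ≤ (1 + D) ^ q₀ * D ^ (p - q₀ - s) * X := by
          rw [h3, hX]
          gcongr
      _ ≤ _ := by nlinarith [mul_nonneg hM₁0 hX0]

namespace IsCircleLift

variable {Φ : ℝ → ℝ}

/-- The mean height of the image of a horizontal line. -/
lemma setIntegral_planeExt_im (hΦ : IsCircleLift Φ) (y : ℝ) :
    ∫ x in Set.Ioc (-Real.pi) Real.pi, (planeExt Φ ⟨x, y⟩).im = 2 * Real.pi * y := by
  obtain ⟨B, hB0, hB⟩ := hΦ.exists_bound
  have hper : Function.Periodic (fun s => Φ s - s) (2 * Real.pi) := fun t => by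
    simp only [hΦ.add_two_pi]; ring
  have hc := hΦ.continuous
  have hk := continuous_quarticKernel
  have hint : Integrable (Function.uncurry fun x t : ℝ =>
      (Φ (x + t * y) - (x + t * y)) * t * quarticKernel t)
      ((volume.restrict (Set.Ioc (-Real.pi) Real.pi)).prod volume) := by
    refine ((integrable_abs_mul_quarticKernel.const_mul B).comp_snd
      (volume.restrict (Set.Ioc (-Real.pi) Real.pi))).mono' ?_ (.of_forall fun z => ?_)
    · exact Continuous.aestronglyMeasurable (by fun_prop)
    · exact (abs_mul_quarticKernel_le (hB _) z.2).2
  have hswap := integral_integral_swap hint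
  -- The integral of Φ(s) - s over a full period does not depend on the shift ty, so after Fubini
  -- only the vanishing first moment of the kernel remains.
  have hinner : ∀ t : ℝ, ∫ x in Set.Ioc (-Real.pi) Real.pi,
      (Φ (x + t * y) - (x + t * y)) * t * quarticKernel t =
      (∫ x in (-Real.pi)..Real.pi, (Φ x - x)) * (t * quarticKernel t) := fun t => by
    have hle : -Real.pi ≤ Real.pi := by linarith [Real.pi_pos]
    simp_rw [mul_assoc]
    rw [integral_mul_const, ← intervalIntegral.integral_of_le hle,
      intervalIntegral.integral_comp_add_right (fun s => Φ s - s)]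
    have := hper.intervalIntegral_add_eq (-Real.pi + t * y) (-Real.pi)
    rw [show -Real.pi + t * y + 2 * Real.pi = Real.pi + t * y by ring,
      show -Real.pi + 2 * Real.pi = Real.pi by ring] at this
    rw [this]
  simp_rw [hinner] at hswap
  rw [integral_const_mul, integral_id_mul_quarticKernel, mul_zero] at hswap
  simp_rw [hΦ.planeExt_im]
  have hil : Integrable (fun x => ∫ t, (Φ (x + t * y) - (x + t * y)) * t * quarticKernel t)
      (volume.restrict (Set.Ioc (-Real.pi) Real.pi)) := hint.integral_prod_left
  rw [integral_add (integrable_const _) hil, hswap, add_zero,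
    setIntegral_const, smul_eq_mul, Real.volume_real_Ioc_of_le (by linarith [Real.pi_pos])]
  ring

lemma weightedEnergy_discExt_lt_top (hΦ : IsCircleLift Φ) {p β : ℝ} (hp₁ : 1 ≤ p) (hp₂ : p < 2)
    (hpβ : p * β < 1) : weightedEnergy p β (discExt Φ) < ∞ := by
  have hπ := Real.pi_pos
  obtain ⟨c, hc0, hc⟩ := hΦ.exists_norm_fderiv_discExt_le
  obtain ⟨B, hB0, hB⟩ := hΦ.exists_planeExt_im_le
  obtain ⟨M, hM0, hM⟩ := exists_density_le hp₁ hpβ hc0 hB0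
  set a := min (p - max (p * β) 0) 1 - p with ha
  -- Both entries of the minimum exceed p - 1: the first because pβ < 1, the second because p < 2.
  have ha1 : -1 < a := by
    have : p - 1 < min (p - max (p * β) 0) 1 :=
      lt_min (by linarith [max_lt hpβ one_pos]) (by linarith)
    linarith
  have ha0 : a ≤ 0 := by
    have := min_le_left (p - max (p * β) 0) 1
    linarith [le_max_right (p * β) 0]
  set f : ℝ → ℝ → ℝ := fun r x =>
    M * (1 + (1 - r) ^ a * (1 + (planeExt Φ ⟨x, -Real.log r⟩).im / (-Real.log r))) with hf
  have hmk : Continuous fun p : ℝ × ℝ => (⟨p.1, p.2⟩ : ℂ) :=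
    Complex.equivRealProdCLM.symm.continuous
  have hbound : weightedEnergy p β (discExt Φ) ≤
      ∫⁻ r in Set.Ioo (0 : ℝ) 1, ∫⁻ x in Set.Ioc (-Real.pi) Real.pi, ENNReal.ofReal (f r x) := by
    have hmeas : Measurable fun z : ℝ × ℝ => ENNReal.ofReal (f z.1 z.2) := by
      have h1 : Measurable fun z : ℝ × ℝ => (planeExt Φ ⟨z.2, -Real.log z.1⟩).im :=
        (Complex.continuous_im.comp (hΦ.continuous_planeExt.comp hmk)).measurable.comp
          (measurable_snd.prodMk (Real.measurable_log.comp measurable_fst).neg)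
      have h2 : Measurable fun z : ℝ × ℝ => -Real.log z.1 :=
        (Real.measurable_log.comp measurable_fst).neg
      exact ((((((measurable_const.sub measurable_fst).pow_const a).mul
        ((h1.div h2).const_add 1)).const_add 1).const_mul M)).ennreal_ofReal
    rw [← lintegral_prod (μ := volume.restrict (Set.Ioo (0 : ℝ) 1))
      (ν := volume.restrict (Set.Ioc (-Real.pi) Real.pi)) _ hmeas.aemeasurable,
      Measure.prod_restrict, weightedEnergy, ← lintegral_indicator isOpen_ball.measurableSet,
      ← Complex.lintegral_comp_polarCoord_symm, ← Measure.volume_eq_prod,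
      ← lintegral_indicator (measurableSet_Ioo.prod measurableSet_Ioc),
      ← lintegral_indicator (polarCoord.open_target.measurableSet)]
    refine lintegral_mono fun z => ?_
    by_cases hz : z ∈ polarCoord.target
    swap
    · rw [Set.indicator_of_notMem hz]; exact zero_le
    rw [Set.indicator_of_mem hz]
    rw [polarCoord_target] at hz
    obtain ⟨hr0, hx⟩ := hz
    simp only [Set.mem_Ioi] at hr0
    have hexp : Complex.polarCoord.symm z = Complex.exp (Complex.I * ⟨z.2, -Real.log z.1⟩) := by
      have : Complex.I * (⟨z.2, -Real.log z.1⟩ : ℂ) = (Real.log z.1 : ℝ) + (z.2 : ℝ) * Complex.I := by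
        apply Complex.ext <;> simp
      rw [this, Complex.exp_add, ← Complex.ofReal_exp, Real.exp_log hr0, Complex.exp_mul_I,
        Complex.polarCoord_symm_apply]
      push_cast
      rfl
    have hnorm : ‖Complex.polarCoord.symm z‖ = z.1 := by
      rw [hexp, norm_exp_I_mul, neg_neg, Real.exp_log hr0]
    by_cases hr1 : z.1 < 1
    swap
    · rw [Set.indicator_of_notMem (by rwa [mem_ball_zero_iff, hnorm]), smul_zero]; exact zero_le
    rw [Set.indicator_of_mem (by rwa [mem_ball_zero_iff, hnorm]),
      Set.indicator_of_mem (show z ∈ Set.Ioo (0 : ℝ) 1 ×ˢ Set.Ioc (-Real.pi) Real.pi from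
        ⟨⟨hr0, hr1⟩, Set.Ioo_subset_Ioc_self hx⟩), smul_eq_mul,
      ← ENNReal.ofReal_mul hr0.le]
    refine ENNReal.ofReal_le_ofReal ?_
    have hy : 0 < -Real.log z.1 := neg_pos.2 (Real.log_neg hr0 hr1)
    set ζ : ℂ := ⟨z.2, -Real.log z.1⟩ with hζ
    have hV : 0 < (planeExt Φ ζ).im := (hΦ.planeExt_im_pos_iff ζ).2 hy
    have hd := hM (planeExt Φ ζ).im (-Real.log z.1) _ hV hy (hB ζ).1 (norm_nonneg _) (hc ζ hy)
    have hpos : 0 ≤ ‖fderiv ℝ (discExt Φ) (Complex.exp (Complex.I * ζ))‖ ^ p /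
        (1 - Real.exp (-(planeExt Φ ζ).im)) ^ (p * β) := by
      have : Real.exp (-(planeExt Φ ζ).im) ≤ 1 := Real.exp_le_one_iff.2 (by linarith)
      exact div_nonneg (by positivity) (Real.rpow_nonneg (by linarith) _)
    rw [hexp, hΦ.discExt_exp, norm_exp_I_mul]
    -- The polar Jacobian r < 1 is dropped; then -log r ≥ 1 - r and a ≤ 0 replace the height by 1 -
    -- r.
    refine (mul_le_of_le_one_left hpos hr1.le).trans (hd.trans ?_)
    have hlog : (-Real.log z.1) ^ a ≤ (1 - z.1) ^ a :=
      Real.rpow_le_rpow_of_nonpos (by linarith) (by linarith [Real.log_le_sub_one_of_pos hr0]) ha0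
    simp only [hf]
    gcongr
  refine hbound.trans_lt ?_
  -- The mean of v/y over a period is 1, which produces the factor 2.
  have hinner : ∀ r ∈ Set.Ioo (0 : ℝ) 1,
      ∫⁻ x in Set.Ioc (-Real.pi) Real.pi, ENNReal.ofReal (f r x) =
        ENNReal.ofReal (M * (2 * Real.pi * (1 + 2 * (1 - r) ^ a))) := fun r hr => by
    have hy : 0 < -Real.log r := neg_pos.2 (Real.log_neg hr.1 hr.2)
    have hcont : Continuous fun x : ℝ => (planeExt Φ ⟨x, -Real.log r⟩).im :=
      Complex.continuous_im.comp (hΦ.continuous_planeExt.comp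
        (hmk.comp (by fun_prop : Continuous fun x : ℝ => (x, -Real.log r))))
    have hci : ∀ g : ℝ → ℝ, Continuous g → IntegrableOn g (Set.Ioc (-Real.pi) Real.pi) :=
      fun g hg => hg.integrableOn_Ioc
    rw [← ofReal_integral_eq_lintegral_ofReal (hci _ (by simp only [hf]; fun_prop))
      (.of_forall fun x => ?_)]
    · congr 1
      simp only [hf]
      have i1 := hci _ hcont
      have i2 : IntegrableOn (fun _ : ℝ => (1 : ℝ)) (Set.Ioc (-Real.pi) Real.pi) :=
        hci _ continuous_const
      have e1 : ∫ x in Set.Ioc (-Real.pi) Real.pi, (1 : ℝ) = 2 * Real.pi := by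
        rw [setIntegral_const, smul_eq_mul, Real.volume_real_Ioc_of_le (by linarith)]
        ring
      have i3 : IntegrableOn (fun x => 1 + (planeExt Φ ⟨x, -Real.log r⟩).im / -Real.log r)
        (Set.Ioc (-Real.pi) Real.pi) := i2.add (i1.div_const _)
      rw [integral_const_mul, integral_add i2 (i3.const_mul _),
        integral_const_mul, integral_add i2 (i1.div_const _), integral_div,
        hΦ.setIntegral_planeExt_im, e1, mul_div_assoc, div_self hy.ne']
      ring
    · have hV : 0 < (planeExt Φ ⟨x, -Real.log r⟩).im := (hΦ.planeExt_im_pos_iff _).2 hy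
      have : 0 < 1 - r := by linarith [hr.2]
      simp only [hf, Pi.zero_apply]
      positivity
  rw [setLIntegral_congr_fun measurableSet_Ioo hinner]
  have hI : IntegrableOn (fun r : ℝ => (1 - r) ^ a) (Set.Ioo 0 1) := by
    have h := (intervalIntegral.intervalIntegrable_rpow' (a := 0) (b := 1) ha1).comp_sub_left 1
    simp only [sub_zero, sub_self] at h
    rw [← integrableOn_Ioc_iff_integrableOn_Ioo]
    exact (intervalIntegrable_iff_integrableOn_Ioc_of_le zero_le_one).1 h.symm
  have hI2 : IntegrableOn (fun r : ℝ => M * (2 * Real.pi * (1 + 2 * (1 - r) ^ a)))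
      (Set.Ioo 0 1) :=
    (((integrableOn_const (by simp)).add (hI.const_mul 2)).const_mul _).const_mul _
  exact hI2.lintegral_lt_top

end IsCircleLift

/-! ### Lifting circle homeomorphisms -/

/-- The point of the unit circle with argument `t`. -/
noncomputable def spherePoint (t : ℝ) : sphere (0 : ℂ) 1 :=
  ⟨Complex.exp (Complex.I * t), by simp [norm_exp_I_mul]⟩

lemma spherePoint_eq_iff {s t : ℝ} :
    spherePoint s = spherePoint t ↔ ∃ n : ℤ, s = t + n * (2 * Real.pi) := by
  rw [Subtype.ext_iff, spherePoint, spherePoint, exp_I_mul_eq_iff]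
  exact exists_congr fun n => by norm_cast

lemma exists_spherePoint_eq (ζ : sphere (0 : ℂ) 1) : ∃ t, spherePoint t = ζ := by
  have hζ : ‖(ζ : ℂ)‖ = 1 := by simp
  refine ⟨Complex.arg ζ, Subtype.ext ?_⟩
  have := Complex.norm_mul_exp_arg_mul_I (ζ : ℂ)
  rwa [hζ, Complex.ofReal_one, one_mul, mul_comm] at this

lemma continuous_spherePoint : Continuous spherePoint := by
  unfold spherePoint
  fun_prop

lemma coe_circle_exp (t : ℝ) : (Circle.exp t : ℂ) = spherePoint t := by
  rw [Circle.coe_exp, mul_comm]; rfl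

lemma eq_of_spherePoint_comp_eq {f g : ℝ → ℝ} (hf : Continuous f) (hg : Continuous g)
    (h : ∀ t, spherePoint (f t) = spherePoint (g t)) (h0 : f 0 = g 0) (t : ℝ) : f t = g t := by
  refine congrFun (Circle.isCoveringMap_exp.eq_of_comp_eq hf hg (funext fun s => ?_) 0 h0) t
  refine Circle.ext ?_
  simp only [Function.comp, coe_circle_exp, h]

lemma exists_lift_spherePoint {φ : sphere (0 : ℂ) 1 → sphere (0 : ℂ) 1} (hφ : Continuous φ) :
    ∃ Φ : ℝ → ℝ, Continuous Φ ∧ ∀ t, φ (spherePoint t) = spherePoint (Φ t) := by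
  let f : C(ℝ, Circle) := ⟨fun t => ⟨φ (spherePoint t), (φ (spherePoint t)).2⟩,
    ((continuous_subtype_val.comp (hφ.comp continuous_spherePoint)).subtype_mk _)⟩
  obtain ⟨s, hs⟩ := exists_spherePoint_eq (φ (spherePoint 0))
  obtain ⟨F, ⟨-, hF⟩, -⟩ := Circle.isCoveringMap_exp.existsUnique_continuousMap_lifts f 0 s
    (Circle.ext (by rw [coe_circle_exp, hs]; rfl))
  refine ⟨F, F.continuous, fun t => Subtype.ext ?_⟩
  rw [← coe_circle_exp]
  exact (congrArg ((↑) : Circle → ℂ) (congrFun hF t)).symm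

/-- The translate of Φ by a period lifts the same map, so uniqueness of lifts makes the difference
constant. -/
lemma exists_degree {φ : sphere (0 : ℂ) 1 → sphere (0 : ℂ) 1} {Φ : ℝ → ℝ} (hΦ : Continuous Φ)
    (h : ∀ t, φ (spherePoint t) = spherePoint (Φ t)) :
    ∃ d : ℤ, ∀ t, Φ (t + 2 * Real.pi) = Φ t + d * (2 * Real.pi) := by
  have h1 : ∀ t, spherePoint (Φ (t + 2 * Real.pi)) = spherePoint (Φ t) := fun t => by
    rw [← h, ← h, (spherePoint_eq_iff (t := t)).2 ⟨1, by simp⟩]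
  obtain ⟨d, hd⟩ := spherePoint_eq_iff.1 (h1 0)
  refine ⟨d, eq_of_spherePoint_comp_eq (by fun_prop) (by fun_prop) (fun t => ?_) hd⟩
  rw [h1, eq_comm, spherePoint_eq_iff]
  exact ⟨d, rfl⟩

/-- Every homeomorphism of the circle has, up to complex conjugation, an increasing lift. -/
lemma exists_isCircleLift (φ : sphere (0 : ℂ) 1 ≃ₜ sphere (0 : ℂ) 1) :
    ∃ (Φ : ℝ → ℝ) (σ : ℂ ≃ₗᵢ[ℝ] ℂ), IsCircleLift Φ ∧
      ∀ t, (φ (spherePoint t) : ℂ) = σ (Complex.exp (Complex.I * Φ t)) := by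
  obtain ⟨Φ, hΦ, hφ⟩ := exists_lift_spherePoint φ.continuous
  obtain ⟨Ψ, hΨ, hψ⟩ := exists_lift_spherePoint φ.symm.continuous
  obtain ⟨d, hd⟩ := exists_degree hΦ hφ
  obtain ⟨e, he⟩ := exists_degree hΨ hψ
  have h1 : ∀ t, spherePoint (Ψ (Φ t)) = spherePoint t := fun t => by
    rw [← hψ, ← hφ, φ.symm_apply_apply]
  obtain ⟨n, hn⟩ := spherePoint_eq_iff.1 (h1 0)
  have h2 : ∀ t, Ψ (Φ t) = t + n * (2 * Real.pi) :=
    eq_of_spherePoint_comp_eq (by fun_prop) (by fun_prop)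
      (fun t => by rw [h1, eq_comm, spherePoint_eq_iff]; exact ⟨n, rfl⟩) hn
  have hinj : Function.Injective Φ := fun a b hab => by
    have := congrArg Ψ hab
    rw [h2, h2] at this
    exact add_right_cancel this
  have he' : Ψ (Φ 0 + d * (2 * Real.pi)) = Ψ (Φ 0) + d * (e * (2 * Real.pi)) := by
    have hp : Function.Periodic (fun t => Ψ t - e * t) (2 * Real.pi) := fun t => by
      simp only [he]; ring
    have := hp.int_mul d (Φ 0)
    linear_combination this
  have hπ := Real.pi_pos
  -- The degrees of φ and its inverse multiply to 1, so d = ±1. Monotonicity fixes the sign, and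
  -- conjugation turns the decreasing case into the increasing one.
  have hde : d * e = 1 := by
    rw [← hd, h2, h2] at he'
    have h3 : ((d * e : ℤ) : ℝ) = 1 := by
      push_cast
      have : (d * e - 1 : ℝ) * (2 * Real.pi) = 0 := by linear_combination -he'
      rcases mul_eq_zero.1 this with h | h
      · linarith
      · linarith
    exact_mod_cast h3
  have h0 := hd 0
  rcases hΦ.strictMono_of_inj hinj with hm | hm
  · refine ⟨Φ, .refl ℝ ℂ, ⟨hΦ, hm, fun t => ?_⟩, fun t => by rw [hφ]; rfl⟩
    rcases Int.eq_one_or_neg_one_of_mul_eq_one hde with h | h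
    · rw [hd, h]; simp
    · have := hm (show (0 : ℝ) < 0 + 2 * Real.pi by linarith)
      rw [h0, h] at this
      push_cast at this
      linarith
  · refine ⟨fun t => -Φ t, Complex.conjLIE, ⟨hΦ.neg, hm.neg, fun t => ?_⟩, fun t => ?_⟩
    · rcases Int.eq_one_or_neg_one_of_mul_eq_one hde with h | h
      · have := hm (show (0 : ℝ) < 0 + 2 * Real.pi by linarith)
        rw [h0, h] at this
        push_cast at this
        linarith
      · rw [hd, h]; push_cast; ring
    · rw [hφ, Complex.conjLIE_apply, ← Complex.exp_conj]
      simp [spherePoint]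

/-! ### Conclusion -/

theorem mainTheorem3 (p β : ℝ) (hp₁ : 1 ≤ p) (hp₂ : p < 2) (hpβ : p * β < 1)
    (φ : sphere (0 : ℂ) 1 ≃ₜ sphere (0 : ℂ) 1) :
    ∃ (H : closedBall (0 : ℂ) 1 ≃ₜ closedBall (0 : ℂ) 1) (h : ℂ → ℂ),
      (∀ z : closedBall (0 : ℂ) 1, h z = H z) ∧
      (∀ ζ : sphere (0 : ℂ) 1, h ζ = φ ζ) ∧
      LocallyLipschitzOn (ball (0 : ℂ) 1) h ∧
      weightedEnergy p β h < ∞ := by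
  obtain ⟨Φ, σ, hΦ, hφ⟩ := exists_isCircleLift φ
  set h : ℂ → ℂ := fun w => σ (discExt Φ w) with hh
  have hcont : Continuous h := σ.continuous.comp hΦ.continuous_discExt
  have hmem : ∀ w, h w ∈ closedBall (0 : ℂ) 1 ↔ w ∈ closedBall (0 : ℂ) 1 := fun w => by
    rw [mem_closedBall_zero_iff, mem_closedBall_zero_iff, hh, σ.norm_map,
      hΦ.norm_discExt_le_one_iff]
  let f : closedBall (0 : ℂ) 1 → closedBall (0 : ℂ) 1 := fun z => ⟨h z, (hmem z).2 z.2⟩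
  have hf : Function.Bijective f := by
    refine ⟨fun a b hab => Subtype.ext (hΦ.discExt_injective (σ.injective ?_)), fun b => ?_⟩
    · exact congrArg Subtype.val hab
    · obtain ⟨w, hw⟩ := hΦ.discExt_surjective (σ.symm b)
      have hw' : h w = b := by rw [hh]; simp [hw]
      exact ⟨⟨w, (hmem w).1 (hw' ▸ b.2)⟩, Subtype.ext hw'⟩
  have hfc : Continuous (Equiv.ofBijective f hf) :=
    (hcont.comp continuous_subtype_val).subtype_mk _
  refine ⟨hfc.homeoOfEquivCompactToT2, h, fun z => rfl, fun ζ => ?_, fun x hx => ?_, ?_⟩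
  · obtain ⟨t, rfl⟩ := exists_spherePoint_eq ζ
    rw [hφ, hh, ← hΦ.discExt_exp_ofReal]
    rfl
  · obtain ⟨K, t, ht, hK⟩ := hΦ.locallyLipschitzOn_discExt hx
    exact ⟨_, t, ht, σ.lipschitz.comp_lipschitzOnWith hK⟩
  -- Composition with the real-linear isometry σ changes neither the norm of the differential nor
  -- |h|.
  · have henergy : weightedEnergy p β h = weightedEnergy p β (discExt Φ) := by
      have h1 : ∀ w, fderiv ℝ h w =
          σ.toLinearIsometry.toContinuousLinearMap.comp (fderiv ℝ (discExt Φ) w) :=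
        fun w => σ.comp_fderiv
      simp only [weightedEnergy, h1, LinearIsometry.norm_toContinuousLinearMap_comp]
      simp only [hh, σ.norm_map]
    rw [henergy]
    exact hΦ.weightedEnergy_discExt_lt_top hp₁ hp₂ hpβ
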